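/- Let $n\ge 2$ microgrids have cost functions $f_i(x)=\tfrac12 a_ix^2+b_ix$ with $a_i,b_i>0$, load demands $P_i^d$ and generation limits $\underline P_i^g,\overline P_i^g$, and consider the dispatch problem $$\min_{P^g}\ \sum_i f_i(P_i^g)\quad\text{s.t.}\quad \sum_i P_i^g=\sum_i P_i^d,\qquad \underline P_i^g\le P_i^g\le\overline P_i^g .\qquad(\ast)$$ Assume that $(\ast)$ is feasible (Slater's condition, the constraints being affine). Let $L$ be the Laplacian matrix of a connected undirected communication graph on the microgrids, with neighbor sets $N_i$, let $\sigma_{\max}$ be its largest eigenvalue, $a_{\min}=\min_i a_i$, $a_{\max}=\max_i a_i$, $\zeta=\min\{1/\sigma_{\max}^2,\ a_{\min}/a_{\max}^2\}$ and $\kappa>1/(2\zeta)$. Let $\sigma_\mu,\sigma_z,\sigma_g>0$ be such that $\Phi-\kappa I$ is positive semidefinite, where $$\Phi=\begin{bmatrix}\sigma_\mu^{-1}I&L&I\\ L&\sigma_z^{-1}I&0\\ I&0&\sigma_g^{-1}I\end{bmatrix}.$$ For a state $w=(\mu,z,P^g)\in\mathbb R^{3n}$ define $\mathcal T(w)=(\tilde\mu,\tilde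 z,\tilde P^g)$ by $$\tilde\mu_i=\mu_i+\sigma_\mu\Big(-\sum_{j\in N_i}(\mu_i-\mu_j)+\sum_{j\in N_i}(z_i-z_j)+P_i^g-P_i^d\Big),$$ $$\tilde z_i=z_i-\sigma_z\Big(2\sum_{j\in N_i}(\tilde\mu_i-\tilde\mu_j)-\sum_{j\in N_i}(\mu_i-\mu_j)\Big),$$ $$\tilde P_i^g=\mathcal P_{[\underline P_i^g,\overline P_i^g]}\big(P_i^g-\sigma_g(f_i'(P_i^g)+2\tilde\mu_i-\mu_i)\big),$$ where $\mathcal P_{[\alpha,\beta]}$ is the projection onto $[\alpha,\beta]$. Write $w_i=(\mu_i,z_i,P_i^g)$. Consider the asynchronous algorithm ASDPD on a global clock $k=0,1,2,\dots$, started at a state $w_0$ with $\underline P_i^g\le P_{i,0}^g\le\overline P_i^g$ for all $i$. At iteration $k$ one microgrid $i_k$ is activated, the available information is $\hat w_k=(w_{j,\,k-\tau_j^k})_j$ with random delays $\tau_j^k$ (reads before time $0$ return $w_0$), and $$w_{i_k,k+1}=w_{i_k,k}+\eta_k\big(\mathcal T(\hat w_k)_{i_k}-\hat w_{i_k,k}\big),\qquad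 w_{j,k+1}=w_{j,k}\quad(j\ne i_k).$$ Assume that $i_k$ is uniformly distributed on the $n$ microgrids and independent of $(i_0,\dots,i_{k-1})$ and of the delays used at iterations $0,\dots,k$ (jointly), and that $0\le\tau_j^k\le\chi$ for all $j,k$, where $\chi\in\mathbb N$. Let the step sizes $\eta_k$ satisfy, for some constant $\eta_{\min}>0$ and all $k$, $$\eta_{\min}\le\eta_k<\frac{1}{1+2\chi/\sqrt n}\cdot\frac{4\kappa\zeta-1}{2\kappa\zeta}.$$ Then, with probability $1$, $P^g_k$ converges to some $P^{g*}$ and all components $\mu_{i,k}$ of $\mu_k$ converge to a common $\mu^*$ such that $(P^{g*},\mu^*)$ is a primal-dual optimal solution of $(\ast)$: $P^{g*}$ solves $(\ast)$, and $\mu^*$ is the multiplier of the power balance in a solution of the Lagrange dual problem of $(\ast)$. -/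

import Mathlib

open Filter Topology MeasureTheory ProbabilityTheory

namespace Dispatch

/-- Data of the economic dispatch problem with `n` microgrids: quadratic cost coefficients
`a i > 0`, `b i > 0`, load demands `d i`, and generation limits `lo i`, `hi i`. -/
structure Problem (n : ℕ) where
  a : Fin n → ℝ
  b : Fin n → ℝ
  d : Fin n → ℝ
  lo : Fin n → ℝ
  hi : Fin n → ℝ
  a_pos : ∀ i, 0 < a i
  b_pos : ∀ i, 0 < b i

namespace Problem

variable {n : ℕ}

/-- The generation cost `f_i(x) = a_i x² / 2 + b_i x`. -/
noncomputable def cost (pr : Problem n) (i : Fin n) (x : ℝ) : ℝ :=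
  1 / 2 * pr.a i * x ^ 2 + pr.b i * x

/-- The derivative `f_i'`. -/
def marginalCost (pr : Problem n) (i : Fin n) (x : ℝ) : ℝ := pr.a i * x + pr.b i

theorem hasDerivAt_cost (pr : Problem n) (i : Fin n) (x : ℝ) :
    HasDerivAt (pr.cost i) (pr.marginalCost i x) x := by
  have h := (((hasDerivAt_id x).pow 2).const_mul (1 / 2 * pr.a i)).add
    ((hasDerivAt_id x).const_mul (pr.b i))
  refine h.congr_deriv ?_
  simp [marginalCost]
  ring

/-- The total generation cost. -/
noncomputable def totalCost (pr : Problem n) (P : Fin n → ℝ) : ℝ := ∑ i, pr.cost i (P i)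

/-- Feasible dispatches: power balance and generation limits. -/
def feasibleSet (pr : Problem n) : Set (Fin n → ℝ) :=
  {P | ∑ i, P i = ∑ i, pr.d i ∧ ∀ i, pr.lo i ≤ P i ∧ P i ≤ pr.hi i}

def IsPrimalOptimal (pr : Problem n) (P : Fin n → ℝ) : Prop :=
  P ∈ pr.feasibleSet ∧ ∀ Q ∈ pr.feasibleSet, pr.totalCost P ≤ pr.totalCost Q

/-- The Lagrangian, with multiplier `m` of the power balance and multipliers `gm`, `gp` of the
lower and upper generation limits. -/
noncomputable def lagrangian (pr : Problem n) (P : Fin n → ℝ) (m : ℝ) (gm gp : Fin n → ℝ) : ℝ :=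
  pr.totalCost P + m * (∑ i, P i - ∑ i, pr.d i)
    + ∑ i, gm i * (pr.lo i - P i) + ∑ i, gp i * (P i - pr.hi i)

/-- The Lagrange dual function. -/
noncomputable def dualFunction (pr : Problem n) (m : ℝ) (gm gp : Fin n → ℝ) : EReal :=
  ⨅ P : Fin n → ℝ, (pr.lagrangian P m gm gp : EReal)

/-- `(m, gm, gp)` solves the Lagrange dual problem. -/
def IsDualOptimal (pr : Problem n) (m : ℝ) (gm gp : Fin n → ℝ) : Prop :=
  (∀ i, 0 ≤ gm i) ∧ (∀ i, 0 ≤ gp i) ∧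
    ∀ (m' : ℝ) (gm' gp' : Fin n → ℝ), (∀ i, 0 ≤ gm' i) → (∀ i, 0 ≤ gp' i) →
      pr.dualFunction m' gm' gp' ≤ pr.dualFunction m gm gp

/-- `P` solves the dispatch problem, and `m` is the power-balance component of a solution of
its Lagrange dual. -/
def IsPrimalDualOptimal (pr : Problem n) (P : Fin n → ℝ) (m : ℝ) : Prop :=
  pr.IsPrimalOptimal P ∧ ∃ gm gp : Fin n → ℝ, pr.IsDualOptimal m gm gp

/-- The Euclidean projection onto the interval `[lo i, hi i]`. -/
noncomputable def proj (pr : Problem n) (i : Fin n) (x : ℝ) : ℝ :=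
  max (pr.lo i) (min (pr.hi i) x)

theorem proj_spec (pr : Problem n) (i : Fin n) (h : pr.lo i ≤ pr.hi i) (x : ℝ) :
    pr.proj i x ∈ Set.Icc (pr.lo i) (pr.hi i) ∧
      ∀ y ∈ Set.Icc (pr.lo i) (pr.hi i), |x - pr.proj i x| ≤ |x - y| := by
  unfold proj
  refine ⟨⟨le_max_left _ _, max_le h (min_le_left _ _)⟩, ?_⟩
  rintro y ⟨hy1, hy2⟩
  grind

/-- `ζ = min {1 / σ_max², a_min / a_max²}`. -/
noncomputable def zeta (pr : Problem n) (sigmaMax : ℝ) : ℝ :=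
  min (1 / sigmaMax ^ 2) ((⨅ i, pr.a i) / (⨆ i, pr.a i) ^ 2)

end Problem

/-- The largest eigenvalue of the graph Laplacian. -/
noncomputable def maxLaplacianEigenvalue {n : ℕ} (G : SimpleGraph (Fin n)) [DecidableRel G.Adj] :
    ℝ :=
  sSup (spectrum ℝ (G.lapMatrix ℝ))

/-- The matrix `Φ = [[σ_μ⁻¹ I, L, I], [L, σ_z⁻¹ I, 0], [I, 0, σ_g⁻¹ I]]`. -/
noncomputable def Phi {n : ℕ} (G : SimpleGraph (Fin n)) [DecidableRel G.Adj]
    (sMu sZ sG : ℝ) : Matrix (Fin n ⊕ Fin n ⊕ Fin n) (Fin n ⊕ Fin n ⊕ Fin n) ℝ :=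
  Matrix.fromBlocks (sMu⁻¹ • 1) (Matrix.fromCols (G.lapMatrix ℝ) 1)
    (Matrix.fromRows (G.lapMatrix ℝ) 1)
    (Matrix.fromBlocks (sZ⁻¹ • 1) 0 0 (sG⁻¹ • 1))

/-- The joint state `w = (μ, z, P^g)`; microgrid `i` owns the components `mu i`, `z i`, `P i`. -/
@[ext] structure State (n : ℕ) where
  mu : Fin n → ℝ
  z : Fin n → ℝ
  P : Fin n → ℝ

section Algorithm

variable {n : ℕ} (pr : Problem n) (G : SimpleGraph (Fin n)) [DecidableRel G.Adj] (sMu sZ sG : ℝ)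

/-- `∑_{j ∈ N_i} (x_i - x_j)`. -/
def neighborDiff (x : Fin n → ℝ) (i : Fin n) : ℝ := ∑ j ∈ G.neighborFinset i, (x i - x j)

/-- The intermediate value `μ̃`, computed from the state `w`. -/
def muTilde (w : State n) (i : Fin n) : ℝ :=
  w.mu i + sMu * (-neighborDiff G w.mu i + neighborDiff G w.z i + w.P i - pr.d i)

/-- The intermediate value `z̃`. Since `μ̃` is affine in `w`, its neighbor differences only
involve the neighbors and two-hop neighbors of `i`. -/
def zTilde (w : State n) (i : Fin n) : ℝ :=
  w.z i - sZ * (2 * neighborDiff G (muTilde pr G sMu w) i - neighborDiff G w.mu i)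

/-- The intermediate value `P̃^g`. -/
noncomputable def PTilde (w : State n) (i : Fin n) : ℝ :=
  pr.proj i (w.P i - sG * (pr.marginalCost i (w.P i) + 2 * muTilde pr G sMu w i - w.mu i))

/-- The delayed information available at (global) iteration `k`: all components of microgrid `j`
are read with delay `τ j`. Reading before time `0` means reading the initial state. -/
def delayedState (w : ℕ → State n) (k : ℕ) (τ : Fin n → ℕ) : State n where
  mu j := (w (k - τ j)).mu j
  z j := (w (k - τ j)).z j
  P j := (w (k - τ j)).P j

/-- `w` is a run of the asynchronous distributed algorithm from `w0`, when microgrid `act k` is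
activated at global iteration `k` and the information on microgrid `j` has delay `τ k j`. The
activated microgrid adds to its components `η k` times the increment computed from the delayed
information; all the other microgrids keep their components. -/
structure IsRun (η : ℕ → ℝ) (w0 : State n) (act : ℕ → Fin n) (τ : ℕ → Fin n → ℕ)
    (w : ℕ → State n) : Prop where
  init : w 0 = w0
  mu_step : ∀ k, (w (k + 1)).mu (act k) = (w k).mu (act k) +
    η k * (muTilde pr G sMu (delayedState w k (τ k)) (act k)
      - (delayedState w k (τ k)).mu (act k))
  z_step : ∀ k, (w (k + 1)).z (act k) = (w k).z (act k) +
    η k * (zTilde pr G sMu sZ (delayedState w k (τ k)) (act k)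
      - (delayedState w k (τ k)).z (act k))
  P_step : ∀ k, (w (k + 1)).P (act k) = (w k).P (act k) +
    η k * (PTilde pr G sMu sG (delayedState w k (τ k)) (act k)
      - (delayedState w k (τ k)).P (act k))
  idle : ∀ k j, j ≠ act k → (w (k + 1)).mu j = (w k).mu j ∧ (w (k + 1)).z j = (w k).z j ∧
    (w (k + 1)).P j = (w k).P j

end Algorithm

/-- Uniformly random activation with random delays: `ℱ k` is the information before the
microgrid of iteration `k` is drawn, including the delays with which that iteration reads; the
activated microgrid `act k` is uniformly distributed and independent of `ℱ k`. -/
structure IsUniformActivation {Ω : Type*} {mΩ : MeasurableSpace Ω} (Pr : Measure Ω) {n : ℕ}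
    (ℱ : Filtration ℕ mΩ) (act : ℕ → Ω → Fin n) (τ : ℕ → Fin n → Ω → ℕ) : Prop where
  measurable_act : ∀ k, Measurable[ℱ (k + 1)] (act k)
  measurable_delay : ∀ k j, Measurable[ℱ k] (τ k j)
  uniform : ∀ k i, Pr {ω | act k ω = i} = (n : ENNReal)⁻¹
  indep : ∀ k, Indep (MeasurableSpace.comap (act k) ⊤) (ℱ k) Pr

end Dispatch

/-!
The operator `𝒯` is a preconditioned forward-backward step: with the positive definite matrix `Φ`
as a metric, `Φ (w - 𝒯 w) - C w ∈ M (𝒯 w)`, where `C w = (L μ + d, 0, f' (P))` is cocoercive and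
`M w = (- L z - P, L μ, μ + N (P))` is monotone, `N` being the normal cone of the generation
limits. Its fixed points are the consensus states at primal-dual solutions
(`exists_isPrimalDualOptimal_of_residual_eq_zero`), and they exist, because the individually
optimal dispatches at a common price meet the demand for a suitable price (`exists_price`,
`exists_residual_eq_zero`).

The asynchronous iteration moves one random block along the residual `s = w - 𝒯 w` at a delayed
state. `ae_tendsto_zero_of_async` proves its almost sure convergence for an arbitrary inner
product, from two inequalities: `2 ⟪s, w - w*⟫` has to exceed `θ` times the square norm of `s`,
and also `θ` times the sum of the square norms of the blocks of `s`, by a fixed multiple of the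
square norm of `s`. The Lyapunov function is the square distance to a fixed point plus a weighted
sum of the recent square increments, which absorbs the delays (`average_step_le`). It is a
nonnegative supermartingale, hence it converges, and the residuals are square summable
(`ae_summable_and_tendsto`). Doing this for a countable dense set of fixed points, Opial's
argument (`exists_tendsto_zero_of_fejer`) gives the limit.

The point which needs care is that `Φ` is not block diagonal with respect to the microgrids: the
blocks of `s = (p, z, r)` have a total square `Φ`-norm which differs from that of `s` by `2 p ⬝ A
z`, with the adjacency matrix `A` (`sum_phiBilin_single`). The first inequality is that `𝒯` is
averaged. For the second one, averagedness is not enough, and the remainder of the estimate is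
kept: `le_phiBilin_residual` bounds `2 ⟪s, w - w*⟫` from below by `θ ‖s‖² + slack`, using that the
`z`-row of `M` is an equation, and `exists_le_slack_sub_coupling` shows that the slack dominates
the coupling `2 θ p ⬝ A z`. This rests on `c = 1 / ζ ≥ σ_max²`. With at least three microgrids,
`16 A² ≤ c (c - L)` suffices (`adjMatrix_mulVec_sq_le_slack`); it follows from `‖A‖ ≤ max degree ≤
σ_max - 1` and `σ_max ≥ 17 / 5` when there are at least four. With two microgrids that inequality
fails, and the link between `z` and the `μ`-components, together with the part of `Φ` above `κ`,
has to be used (`exists_le_slack_sub_coupling_of_two`).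
-/

namespace Dispatch

/-! ### Simple random variables -/

/-- `f` takes finitely many values, and each of them on an `m`-measurable set. Unlike measurability,
this notion is stable under composition with arbitrary functions. -/
def IsSimple {Ω β : Type*} (m : MeasurableSpace Ω) (f : Ω → β) : Prop :=
  (∀ b, MeasurableSet[m] (f ⁻¹' {b})) ∧ (Set.range f).Finite

namespace IsSimple

variable {Ω α β γ : Type*} {m m' : MeasurableSpace Ω}

theorem const (b : β) : IsSimple m fun _ : Ω => b :=
  ⟨fun c => measurable_const (MeasurableSpace.measurableSet_top (s := {c})),
    Set.finite_range_const⟩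

theorem mono {f : Ω → β} (hf : IsSimple m f) (h : m ≤ m') : IsSimple m' f :=
  ⟨fun b => h _ (hf.1 b), hf.2⟩

theorem measurableSet_preimage {f : Ω → β} (hf : IsSimple m f) (s : Set β) :
    MeasurableSet[m] (f ⁻¹' s) := by
  have : f ⁻¹' s = ⋃ b ∈ Set.range f ∩ s, f ⁻¹' {b} := by
    ext ω; simp
  rw [this]
  exact MeasurableSet.biUnion (hf.2.inter_of_left s).countable fun b _ => hf.1 b

theorem comp {f : Ω → β} (hf : IsSimple m f) (g : β → γ) : IsSimple m fun ω => g (f ω) :=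
  ⟨fun c => hf.measurableSet_preimage (g ⁻¹' {c}), by
    have := hf.2.image g
    rwa [← Set.range_comp] at this⟩

theorem pi {ι : Type*} [Finite ι] {β : ι → Type*} {f : ∀ i, Ω → β i}
    (hf : ∀ i, IsSimple m (f i)) : IsSimple m fun ω i => f i ω := by
  constructor
  · intro b
    have : (fun ω i => f i ω) ⁻¹' {b} = ⋂ i, f i ⁻¹' {b i} := by
      ext ω; simp [funext_iff]
    rw [this]
    exact MeasurableSet.iInter fun i => (hf i).1 _
  · refine (Set.Finite.pi' fun i => (hf i).2).subset ?_
    rintro _ ⟨ω, rfl⟩ i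
    exact ⟨ω, rfl⟩

theorem map₂ {f : Ω → α} {g : Ω → β} (hf : IsSimple m f) (hg : IsSimple m g) (h : α → β → γ) :
    IsSimple m fun ω => h (f ω) (g ω) := by
  have : IsSimple m fun ω => (f ω, g ω) := by
    constructor
    · intro b
      have : (fun ω => (f ω, g ω)) ⁻¹' {b} = f ⁻¹' {b.1} ∩ g ⁻¹' {b.2} := by
        ext ω; simp [Prod.ext_iff]
      rw [this]
      exact (hf.1 _).inter (hg.1 _)
    · refine (hf.2.prod hg.2).subset ?_
      rintro _ ⟨ω, rfl⟩
      exact ⟨⟨ω, rfl⟩, ω, rfl⟩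
  exact this.comp fun p => h p.1 p.2

theorem finset_sum {ι : Type*} {s : Finset ι} {f : ι → Ω → ℝ} (hf : ∀ i ∈ s, IsSimple m (f i)) :
    IsSimple m fun ω => ∑ i ∈ s, f i ω := by
  have h : IsSimple m fun ω (i : s) => f i ω := pi fun i => hf i i.2
  have heq : (fun ω => ∑ i ∈ s, f i ω) = fun ω => ∑ i : s, f i ω :=
    funext fun ω => (Finset.sum_coe_sort s fun i => f i ω).symm
  exact heq ▸ h.comp fun v => ∑ i, v i

theorem of_measurable [MeasurableSpace β] [MeasurableSingletonClass β] {f : Ω → β}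
    (hf : Measurable[m] f) (h : (Set.range f).Finite) : IsSimple m f :=
  ⟨fun b => hf (measurableSet_singleton b), h⟩

theorem stronglyMeasurable {f : Ω → ℝ} (hf : IsSimple m f) : StronglyMeasurable[m] f :=
  (show Measurable[m] f from fun s _ => hf.measurableSet_preimage s).stronglyMeasurable

theorem integrable [mΩ : MeasurableSpace Ω] {Pr : Measure Ω} [IsFiniteMeasure Pr] {f : Ω → ℝ}
    (hf : IsSimple m f) (hm : m ≤ mΩ) : Integrable f Pr := by
  obtain ⟨C, hC⟩ := (hf.2.image fun x => ‖x‖).bddAbove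
  refine Integrable.of_bound (C := C) ((hf.stronglyMeasurable.mono hm).aestronglyMeasurable) ?_
  exact Eventually.of_forall fun ω => hC ⟨f ω, ⟨ω, rfl⟩, rfl⟩

end IsSimple

/-! ### Uniform activation -/

section Activation

variable {Ω : Type*} {mΩ : MeasurableSpace Ω} {Pr : Measure Ω} {n : ℕ}
  {ℱ : Filtration ℕ mΩ} {act : ℕ → Ω → Fin n} {τ : ℕ → Fin n → Ω → ℕ}

theorem IsUniformActivation.isSimple_act (hact : IsUniformActivation Pr ℱ act τ) (k : ℕ) :
    IsSimple (ℱ (k + 1)) (act k) :=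
  .of_measurable (hact.measurable_act k) (Set.toFinite _)

theorem IsUniformActivation.isSimple_delay (hact : IsUniformActivation Pr ℱ act τ) {χ : ℕ}
    (hτ : ∀ k j ω, τ k j ω ≤ χ) (k : ℕ) : IsSimple (ℱ k) fun ω j => τ k j ω :=
  .pi fun j => .of_measurable (hact.measurable_delay k j) <|
    (Set.finite_Iic χ).subset (by rintro _ ⟨ω, rfl⟩; exact hτ k j ω)

/-- Conditionally on the past, the activated coordinate averages over all coordinates. -/
theorem IsUniformActivation.condExp_act [IsProbabilityMeasure Pr]
    (hact : IsUniformActivation Pr ℱ act τ) (k : ℕ)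
    {f : Fin n → Ω → ℝ} (hf : ∀ i, IsSimple (ℱ k) (f i)) :
    Pr[fun ω => f (act k ω) ω | ℱ k] =ᵐ[Pr] fun ω => (n : ℝ)⁻¹ * ∑ i, f i ω := by
  set ind : Fin n → Ω → ℝ := fun i => (act k ⁻¹' {i}).indicator fun _ => (1 : ℝ) with hind
  have hle : MeasurableSpace.comap (act k) ⊤ ≤ mΩ :=
    ((hact.measurable_act k).mono (ℱ.le _) le_rfl).comap_le
  have hset : ∀ i, MeasurableSet[MeasurableSpace.comap (act k) ⊤] (act k ⁻¹' {i}) :=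
    fun i => ⟨{i}, trivial, rfl⟩
  have hsum : (fun ω => f (act k ω) ω) = ∑ i, f i * ind i := by
    ext ω
    rw [Finset.sum_apply, Finset.sum_eq_single (act k ω)]
    · simp [hind]
    · intro i _ hi
      simp [hind, hi.symm]
    · simp
  have hind_int : ∀ i, Integrable (ind i) Pr := fun i =>
    (integrable_const (1 : ℝ)).indicator (hle _ (hset i))
  have hint : ∀ i, Integrable (f i * ind i) Pr := fun i => by
    obtain ⟨C, hC⟩ := ((hf i).2.image fun x => ‖x‖).bddAbove
    refine (hind_int i).bdd_mul (c := C)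
      (((hf i).stronglyMeasurable.mono (ℱ.le k)).aestronglyMeasurable) ?_
    exact Eventually.of_forall fun ω => hC ⟨f i ω, ⟨ω, rfl⟩, rfl⟩
  have hone : ∀ i, Pr[ind i | ℱ k] =ᵐ[Pr] fun _ => (n : ℝ)⁻¹ := fun i => by
    have h := condExp_indep_eq (f := ind i) hle (ℱ.le k)
      (stronglyMeasurable_const.indicator (hset i)) (hact.indep k)
    have hval : ∫ ω, ind i ω ∂Pr = (n : ℝ)⁻¹ := by
      rw [hind, integral_indicator_const _ (hle _ (hset i))]
      have : Pr (act k ⁻¹' {i}) = (n : ENNReal)⁻¹ := hact.uniform k i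
      simp [Measure.real, this]
    rw [hval] at h
    exact h
  have hmul : ∀ i, Pr[f i * ind i | ℱ k] =ᵐ[Pr] fun ω => f i ω * (n : ℝ)⁻¹ := fun i => by
    filter_upwards [condExp_mul_of_stronglyMeasurable_left (hf i).stronglyMeasurable (hint i)
      (hind_int i), hone i] with ω h1 h2
    rw [h1, Pi.mul_apply, h2]
  rw [hsum]
  have hall : ∀ᵐ ω ∂Pr, ∀ i, Pr[f i * ind i | ℱ k] ω = f i ω * (n : ℝ)⁻¹ :=
    ae_all_iff.2 hmul
  filter_upwards [condExp_finsetSum (s := Finset.univ) (fun i _ => hint i) (ℱ k), hall]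
    with ω h1 h2
  rw [h1, Finset.sum_apply, Finset.mul_sum]
  exact Finset.sum_congr rfl fun i _ => by rw [h2 i, mul_comm]

end Activation

/-! ### Almost supermartingales -/

/-- A nonnegative process which decreases in conditional mean by at least `u k` converges almost
surely, and `u` is almost surely summable. -/
theorem ae_summable_and_tendsto {Ω : Type*} {mΩ : MeasurableSpace Ω} {Pr : Measure Ω}
    [IsProbabilityMeasure Pr] {ℱ : Filtration ℕ mΩ} {V u : ℕ → Ω → ℝ}
    (hV : ∀ k, IsSimple (ℱ k) (V k)) (hu : ∀ k, IsSimple (ℱ k) (u k))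
    (hV0 : ∀ k ω, 0 ≤ V k ω) (hu0 : ∀ k ω, 0 ≤ u k ω)
    (hdec : ∀ k, Pr[V (k + 1) | ℱ k] ≤ᵐ[Pr] fun ω => V k ω - u k ω) :
    ∀ᵐ ω ∂Pr, Summable (fun k => u k ω) ∧ ∃ c, Tendsto (fun k => V k ω) atTop (𝓝 c) := by
  -- adding up the decrements turns `V` into a nonnegative supermartingale
  set Y : ℕ → Ω → ℝ := fun k ω => V k ω + ∑ l ∈ Finset.range k, u l ω with hY
  have hsum : ∀ k, IsSimple (ℱ k) fun ω => ∑ l ∈ Finset.range (k + 1), u l ω := fun k =>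
    .finset_sum fun l hl => (hu l).mono (ℱ.mono (Nat.lt_succ_iff.1 (Finset.mem_range.1 hl)))
  have hsum' : ∀ k, IsSimple (ℱ k) fun ω => ∑ l ∈ Finset.range k, u l ω := fun k =>
    .finset_sum fun l hl => (hu l).mono (ℱ.mono (Finset.mem_range.1 hl).le)
  have hYs : ∀ k, IsSimple (ℱ k) (Y k) := fun k => (hV k).map₂ (hsum' k) (· + ·)
  have hYi : ∀ k, Integrable (Y k) Pr := fun k => (hYs k).integrable (ℱ.le k)
  have hsuper : Supermartingale Y ℱ Pr := by
    refine supermartingale_nat (fun k => (hYs k).stronglyMeasurable) hYi fun k => ?_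
    have heq : Y (k + 1) = V (k + 1) + fun ω => ∑ l ∈ Finset.range (k + 1), u l ω := rfl
    rw [heq]
    have h1 := condExp_add (m := ℱ k) ((hV (k + 1)).integrable (Pr := Pr) (ℱ.le _))
      ((hsum k).integrable (Pr := Pr) (ℱ.le k))
    have h2 := condExp_of_stronglyMeasurable (μ := Pr) (ℱ.le k) (hsum k).stronglyMeasurable
      ((hsum k).integrable (ℱ.le k))
    filter_upwards [h1, hdec k] with ω h1 h3
    rw [h1, Pi.add_apply, h2]
    simp only [hY, Finset.sum_range_succ]
    linarith
  have hY0 : ∀ k ω, 0 ≤ Y k ω := fun k ω =>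
    add_nonneg (hV0 k ω) (Finset.sum_nonneg fun l _ => hu0 l ω)
  have hbdd : ∀ k, eLpNorm ((-Y) k) 1 Pr ≤ ((∫ ω, Y 0 ω ∂Pr).toNNReal : ENNReal) := fun k => by
    rw [Pi.neg_apply, eLpNorm_neg, eLpNorm_one_eq_lintegral_enorm,
      ← ofReal_integral_norm_eq_lintegral_enorm (hYi k)]
    refine ENNReal.ofReal_le_ofReal ?_
    have : ∀ ω, ‖Y k ω‖ = Y k ω := fun ω => Real.norm_of_nonneg (hY0 k ω)
    simp only [this]
    have := hsuper.setIntegral_le (Nat.zero_le k) (s := Set.univ) MeasurableSet.univ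
    simpa using this
  have hconv := hsuper.neg.ae_tendsto_limitProcess hbdd
  filter_upwards [hconv] with ω hω
  obtain ⟨y, hlim⟩ : ∃ y, Tendsto (fun k => Y k ω) atTop (𝓝 y) := ⟨_, by simpa using hω.neg⟩
  obtain ⟨M, hM⟩ := hlim.bddAbove_range
  have hs : Summable fun k => u k ω := by
    refine summable_of_sum_range_le (c := M) (fun k => hu0 k ω) fun k => ?_
    have := hM ⟨k, rfl⟩
    have := hV0 k ω
    simp only [hY] at *
    linarith
  refine ⟨hs, _, (hlim.sub hs.hasSum.tendsto_sum_nat).congr fun k => ?_⟩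
  simp [hY]

/-! ### Square distances along an averaged step -/

section Algebra

variable {V : Type*} [AddCommGroup V] [Module ℝ V] {B : LinearMap.BilinForm ℝ V}

theorem form_add_self (hsymm : ∀ x y, B x y = B y x) (x y : V) :
    B (x + y) (x + y) = B x x + 2 * B x y + B y y := by
  simp only [map_add, LinearMap.add_apply, hsymm y x]
  ring

theorem form_sub_self (hsymm : ∀ x y, B x y = B y x) (x y : V) :
    B (x - y) (x - y) = B x x - 2 * B x y + B y y := by
  simp only [map_sub, LinearMap.sub_apply, hsymm y x]
  ring

theorem form_sub_self_le (hsymm : ∀ x y, B x y = B y x) (hpos : ∀ x, 0 ≤ B x x) (x y z : V) :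
    B (x - z) (x - z) ≤ 2 * B (x - y) (x - y) + 2 * B (y - z) (y - z) := by
  have h1 := form_add_self hsymm (x - y) (y - z)
  have h2 := form_sub_self hsymm (x - y) (y - z)
  have h3 := hpos (x - y - (y - z))
  rw [sub_add_sub_cancel] at h1
  linarith

/-- One step of the iteration, averaged over the activated block `i`: `U i` is the `i`-th block of
the residual `s` at the delayed point `xh`, and `x - xh` is a sum of at most `χ` earlier
increments `δ l`. -/
theorem average_step_le (hsymm : ∀ x y, B x y = B y x) (hpos : ∀ x, 0 ≤ B x x) {n : ℕ}
    (hn : 0 < n) {x xh s y : V} {U : Fin n → V} (hU : ∑ i, U i = s) {δ : ℕ → V}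
    {J W : Finset ℕ} (hJW : J ⊆ W) {χ : ℕ} (hW : W.card ≤ χ) (hx : x = xh + ∑ l ∈ J, δ l)
    {θ η ε : ℝ} (hη : 0 ≤ η) (hηθ : η * (1 + 2 * (χ / √n)) ≤ θ)
    (hA : θ * B s s + ε ≤ 2 * B s (xh - y))
    (hD : θ * ∑ i, B (U i) (U i) + ε ≤ 2 * B s (xh - y)) :
    (n : ℝ)⁻¹ * ∑ i, (B (x - η • U i - y) (x - η • U i - y)
        + (√n)⁻¹ * (χ * B (η • U i) (η • U i)))
      ≤ B (x - y) (x - y) + (√n)⁻¹ * ∑ l ∈ W, B (δ l) (δ l) - η / n * ε := by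
  have hn' : (0 : ℝ) < n := by exact_mod_cast hn
  set ρ : ℝ := (√n)⁻¹ with hρ
  have hρ0 : 0 < ρ := by positivity
  have hρ2 : ρ ^ 2 = (n : ℝ)⁻¹ := by rw [hρ, inv_pow, Real.sq_sqrt hn'.le]
  set D := ∑ i, B (U i) (U i) with hDdef
  have hD0 : 0 ≤ D := Finset.sum_nonneg fun i _ => hpos _
  have hs0 := hpos s
  have hexp : ∑ i, (B (x - η • U i - y) (x - η • U i - y) + ρ * (χ * B (η • U i) (η • U i)))
      = n * B (x - y) (x - y) - 2 * η * B s (x - y) + η ^ 2 * (1 + ρ * χ) * D := by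
    have h1 : ∀ i, B (x - η • U i - y) (x - η • U i - y) + ρ * (χ * B (η • U i) (η • U i))
        = B (x - y) (x - y) - 2 * η * B (U i) (x - y) + η ^ 2 * (1 + ρ * χ) * B (U i) (U i) := by
      intro i
      rw [show x - η • U i - y = (x - y) - η • U i by abel, form_sub_self hsymm,
        hsymm (x - y) (η • U i)]
      simp only [map_smul, LinearMap.smul_apply, smul_eq_mul]
      ring
    have h2 : ∑ i, B (U i) (x - y) = B s (x - y) := by
      rw [← hU, map_sum, LinearMap.sum_apply]
    simp only [h1, Finset.sum_add_distrib, Finset.sum_sub_distrib, ← Finset.mul_sum, h2,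
      Finset.sum_const, Finset.card_univ, Fintype.card_fin, nsmul_eq_mul, hDdef]
  have hcross : B s (x - y) = B s (xh - y) + ∑ l ∈ J, B s (δ l) := by
    rw [hx, show xh + ∑ l ∈ J, δ l - y = (xh - y) + ∑ l ∈ J, δ l by abel, map_add, map_sum]
  have hcard : (J.card : ℝ) ≤ χ := by exact_mod_cast (Finset.card_le_card hJW).trans hW
  -- Young's inequality, with the weight that makes the coefficient of `B (δ l) (δ l)` constant
  have hyoung : ∀ l, 0 ≤ ρ * B (δ l) (δ l) + 2 * η * ρ ^ 2 * B s (δ l) + η ^ 2 * ρ ^ 3 * B s s := by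
    intro l
    have h := hpos (δ l + (η * ρ) • s)
    rw [form_add_self hsymm] at h
    simp only [map_smul, LinearMap.smul_apply, smul_eq_mul, hsymm (δ l)] at h
    nlinarith [mul_nonneg hρ0.le h]
  have hsumJ : 0 ≤ ρ * ∑ l ∈ J, B (δ l) (δ l) + 2 * η * ρ ^ 2 * ∑ l ∈ J, B s (δ l)
      + J.card * (η ^ 2 * ρ ^ 3 * B s s) := by
    have := Finset.sum_nonneg fun l (_ : l ∈ J) => hyoung l
    simpa [Finset.sum_add_distrib, ← Finset.mul_sum] using this
  have hJle : ∑ l ∈ J, B (δ l) (δ l) ≤ ∑ l ∈ W, B (δ l) (δ l) :=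
    Finset.sum_le_sum_of_subset_of_nonneg hJW fun l _ _ => hpos _
  have hcs : J.card * (η ^ 2 * ρ ^ 3 * B s s) ≤ χ * (η ^ 2 * ρ ^ 3 * B s s) := by gcongr
  have hkey : η * (χ * ρ * B s s + (1 + χ * ρ) * D) + ε ≤ 2 * B s (xh - y) := by
    have hηθ' : η * (1 + 2 * (χ * ρ)) ≤ θ := by rwa [hρ, ← div_eq_mul_inv]
    have hr : 0 ≤ χ * ρ := by positivity
    rcases le_total (B s s) D with h | h
    · have h1 : χ * ρ * B s s + (1 + χ * ρ) * D ≤ (1 + 2 * (χ * ρ)) * D := by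
        nlinarith [mul_le_mul_of_nonneg_left h hr]
      nlinarith [mul_le_mul_of_nonneg_left h1 hη, mul_le_mul_of_nonneg_right hηθ' hD0]
    · have h1 : χ * ρ * B s s + (1 + χ * ρ) * D ≤ (1 + 2 * (χ * ρ)) * B s s := by
        nlinarith [mul_le_mul_of_nonneg_left h hr]
      nlinarith [mul_le_mul_of_nonneg_left h1 hη, mul_le_mul_of_nonneg_right hηθ' hs0]
  have hmul := mul_le_mul_of_nonneg_left hkey (show 0 ≤ η * ρ ^ 2 by positivity)
  have hδ := mul_le_mul_of_nonneg_left hJle hρ0.le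
  rw [hexp, hcross, div_eq_mul_inv, ← hρ2]
  have hnρ : ρ ^ 2 * n = 1 := by rw [hρ2]; exact inv_mul_cancel₀ hn'.ne'
  have hrw : ρ ^ 2 * (n * B (x - y) (x - y) - 2 * η * (B s (xh - y) + ∑ l ∈ J, B s (δ l))
      + η ^ 2 * (1 + ρ * χ) * D) = (ρ ^ 2 * n) * B (x - y) (x - y)
      - 2 * η * ρ ^ 2 * B s (xh - y) - 2 * η * ρ ^ 2 * ∑ l ∈ J, B s (δ l)
      + ρ ^ 2 * (η ^ 2 * (1 + ρ * χ) * D) := by ring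
  rw [hrw, hnρ]
  linarith

end Algebra

/-! ### Opial's argument -/

/-- Opial's argument: if the distance of a sequence to every zero of `S` converges, and all its
cluster points are zeros of `S`, then the sequence converges to a zero of `S`. -/
theorem exists_tendsto_zero_of_fejer {V : Type*} [NormedAddCommGroup V] [NormedSpace ℝ V]
    [FiniteDimensional ℝ V] {B : LinearMap.BilinForm ℝ V} (hsymm : ∀ x y, B x y = B y x)
    {κ : ℝ} (hκ : 0 < κ) (hB : ∀ x, κ * ‖x‖ ^ 2 ≤ B x x) {S : V → V} (hS : Continuous S)
    {D : Set V} (hDne : D.Nonempty) (hD : {y | S y = 0} ⊆ closure D) {x xh : ℕ → V}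
    (hx : ∀ y ∈ D, ∃ c, Tendsto (fun k => B (x k - y) (x k - y)) atTop (𝓝 c))
    (hxh : Tendsto (fun k => x k - xh k) atTop (𝓝 0))
    (hres : Tendsto (fun k => S (xh k)) atTop (𝓝 0)) :
    ∃ y, S y = 0 ∧ Tendsto x atTop (𝓝 y) := by
  have hproper : ProperSpace V := FiniteDimensional.proper ℝ V
  have hBc : Continuous fun v => B v v := by
    have h : Continuous fun v => B.toContinuousBilinearMap v v := by fun_prop
    exact h
  have hpos : ∀ v, 0 ≤ B v v := fun v => (by positivity : 0 ≤ κ * ‖v‖ ^ 2).trans (hB v)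
  have htend : ∀ u : ℕ → V, Tendsto (fun k => B (u k) (u k)) atTop (𝓝 0) →
      Tendsto u atTop (𝓝 0) := by
    intro u hu
    rw [tendsto_zero_iff_norm_tendsto_zero]
    have h2 : Tendsto (fun k => ‖u k‖ ^ 2) atTop (𝓝 0) := by
      refine squeeze_zero (fun k => by positivity) (fun k => ?_)
        (by simpa using hu.const_mul κ⁻¹)
      rw [inv_mul_eq_div, le_div_iff₀ hκ, mul_comm]
      exact hB _
    have h3 := h2.sqrt
    simpa [Real.sqrt_sq] using h3
  obtain ⟨d₀, hd₀⟩ := hDne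
  obtain ⟨c₀, hc₀⟩ := hx d₀ hd₀
  obtain ⟨M, hM⟩ := hc₀.bddAbove_range
  have hbdd : ∀ k, x k ∈ Metric.closedBall d₀ (√(M / κ)) := by
    intro k
    rw [mem_closedBall_iff_norm]
    refine Real.le_sqrt_of_sq_le ?_
    rw [le_div_iff₀ hκ, mul_comm]
    exact (hB _).trans (hM ⟨k, rfl⟩)
  obtain ⟨y, -, φ, hφ, hlim⟩ := (isCompact_closedBall d₀ (√(M / κ))).tendsto_subseq hbdd
  have hlimh : Tendsto (fun k => xh (φ k)) atTop (𝓝 y) := by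
    have h := hlim.sub (hxh.comp hφ.tendsto_atTop)
    simpa using h
  have hSy : S y = 0 :=
    tendsto_nhds_unique ((hS.tendsto y).comp hlimh) (hres.comp hφ.tendsto_atTop)
  refine ⟨y, hSy, ?_⟩
  suffices h : Tendsto (fun k => B (x k - y) (x k - y)) atTop (𝓝 0) by
    have := (htend _ h).add_const y
    simpa using this
  rw [Metric.tendsto_atTop]
  intro ε hε
  have hnear : ∃ d ∈ D, B (d - y) (d - y) < ε / 4 := by
    have hopen : IsOpen {d | B (d - y) (d - y) < ε / 4} :=
      isOpen_lt (hBc.comp (continuous_id.sub continuous_const)) continuous_const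
    obtain ⟨d, hd1, hd2⟩ := mem_closure_iff.1 (hD hSy) _ hopen (by simp; positivity)
    exact ⟨d, hd2, hd1⟩
  obtain ⟨d, hdD, hd⟩ := hnear
  obtain ⟨c, hc⟩ := hx d hdD
  have hcd : c = B (d - y) (d - y) := by
    have h1 := hc.comp hφ.tendsto_atTop
    have h2 : Tendsto (fun k => B (x (φ k) - d) (x (φ k) - d)) atTop (𝓝 (B (y - d) (y - d))) :=
      (hBc.tendsto _).comp (hlim.sub_const d)
    rw [tendsto_nhds_unique h1 h2, ← neg_sub d y, map_neg, map_neg, LinearMap.neg_apply, neg_neg]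
  obtain ⟨N, hN⟩ := eventually_atTop.1 (hc.eventually_lt_const (hcd ▸ hd))
  refine ⟨N, fun k hk => ?_⟩
  rw [Real.dist_0_eq_abs, abs_of_nonneg (hpos _)]
  have := form_sub_self_le hsymm hpos (x k) d y
  linarith [hN k hk]

/-! ### Asynchronous block iterations -/

/-- The iterations `l < k` which are at most `χ` steps before iteration `k`. -/
def window (χ k : ℕ) : Finset ℕ := (Finset.range k).filter fun l => k ≤ l + χ

theorem card_window_le (χ k : ℕ) : (window χ k).card ≤ χ := by
  have : window χ k ⊆ Finset.Ico (k - χ) k := by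
    intro l hl
    simp only [window, Finset.mem_filter, Finset.mem_range, Finset.mem_Ico] at *
    omega
  refine (Finset.card_le_card this).trans ?_
  rw [Nat.card_Ico]
  omega

theorem tendsto_sum_window (χ : ℕ) {a : ℕ → ℝ} (ha : Tendsto a atTop (𝓝 0)) (ha0 : ∀ l, 0 ≤ a l) :
    Tendsto (fun k => ∑ l ∈ window χ k, a l) atTop (𝓝 0) := by
  rw [Metric.tendsto_atTop]
  intro ε hε
  obtain ⟨N, hN⟩ := eventually_atTop.1 (ha.eventually_lt_const (show 0 < ε / (χ + 1) by positivity))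
  refine ⟨N + χ, fun k hk => ?_⟩
  rw [Real.dist_0_eq_abs, abs_of_nonneg (Finset.sum_nonneg fun l _ => ha0 l)]
  have hle : ∑ l ∈ window χ k, a l ≤ (window χ k).card • (ε / (χ + 1)) := by
    refine Finset.sum_le_card_nsmul _ _ _ fun l hl => (hN l ?_).le
    simp only [window, Finset.mem_filter] at hl
    omega
  refine hle.trans_lt ?_
  rw [nsmul_eq_mul]
  have hc : ((window χ k).card : ℝ) ≤ χ := by exact_mod_cast card_window_le χ k
  calc ((window χ k).card : ℝ) * (ε / (χ + 1)) ≤ χ * (ε / (χ + 1)) := by gcongr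
    _ < ε := by
      rw [mul_div_assoc', div_lt_iff₀ (by positivity)]
      nlinarith

/-- Since every step changes a single block, the current state differs from a delayed one by the
sum of a subset of the recent increments. -/
theorem eq_delayed_add_sum {n : ℕ} {E : Type*} [AddCommGroup E] {x : ℕ → Fin n → E}
    {act : ℕ → Fin n} (hidle : ∀ l j, j ≠ act l → x (l + 1) j = x l j) (k : ℕ) (t : Fin n → ℕ) :
    x k = (fun j => x (k - t j) j)
      + ∑ l ∈ (Finset.range k).filter (fun l => k ≤ l + t (act l)), (x (l + 1) - x l) := by
  funext j
  have h1 : ∑ l ∈ (Finset.range k).filter (fun l => k ≤ l + t (act l)), (x (l + 1) j - x l j)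
      = ∑ l ∈ (Finset.range k).filter (fun l => k ≤ l + t j), (x (l + 1) j - x l j) := by
    rw [Finset.sum_filter, Finset.sum_filter]
    refine Finset.sum_congr rfl fun l _ => ?_
    by_cases h : j = act l
    · rw [← h]
    · simp [hidle l j h]
  have h2 : (Finset.range k).filter (fun l => k ≤ l + t j) = Finset.Ico (k - t j) k := by
    ext l
    simp only [Finset.mem_filter, Finset.mem_range, Finset.mem_Ico]
    omega
  rw [Pi.add_apply, Finset.sum_apply]
  simp only [Pi.sub_apply]
  rw [h1, h2, Finset.sum_Ico_sub (fun l => x l j) (Nat.sub_le k (t j))]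
  abel

section Async

variable {Ω : Type*} {mΩ : MeasurableSpace Ω} {Pr : Measure Ω} {n : ℕ}
  {ℱ : Filtration ℕ mΩ} {act : ℕ → Ω → Fin n} {τ : ℕ → Fin n → Ω → ℕ}
  {E : Type*} [NormedAddCommGroup E] [NormedSpace ℝ E]

/-- The iterates of an asynchronous block iteration are simple random variables, determined by the
information before the next activation, and so are the states read with delay. -/
theorem isSimple_iterates (hact : IsUniformActivation Pr ℱ act τ) {χ : ℕ}
    (hτ : ∀ k j ω, τ k j ω ≤ χ) {S : (Fin n → E) → Fin n → E} {η : ℕ → ℝ}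
    {x : ℕ → Ω → Fin n → E} {x0 : Fin n → E} (h0 : ∀ ω, x 0 ω = x0)
    (hx : ∀ k ω, x (k + 1) ω = x k ω
      - η k • (Pi.single (act k ω) (S (fun j => x (k - τ k j ω) ω j) (act k ω)) : Fin n → E))
    (k : ℕ) :
    IsSimple (ℱ k) (x k) ∧ IsSimple (ℱ k) fun ω j => x (k - τ k j ω) ω j := by
  have hdelay : ∀ k, (∀ l ≤ k, IsSimple (ℱ l) (x l)) →
      IsSimple (ℱ k) fun ω j => x (k - τ k j ω) ω j := by
    intro k hk
    have hhist : IsSimple (ℱ k) fun ω (l : Fin (k + 1)) => x l ω :=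
      .pi fun l => (hk l (Nat.lt_succ_iff.1 l.2)).mono (ℱ.mono (Nat.lt_succ_iff.1 l.2))
    exact hhist.map₂ (hact.isSimple_delay hτ k) fun h t j =>
      h ⟨k - t j, Nat.lt_succ_iff.2 (Nat.sub_le _ _)⟩ j
  have hiter : ∀ k, ∀ l ≤ k, IsSimple (ℱ l) (x l) := by
    intro k
    induction k with
    | zero =>
      intro l hl
      obtain rfl : l = 0 := by omega
      rw [show x 0 = fun _ => x0 from funext h0]
      exact .const x0
    | succ k ih =>
      intro l hl
      rcases Nat.lt_or_ge l (k + 1) with h | h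
      · exact ih l (by omega)
      · obtain rfl : l = k + 1 := by omega
        have hle : ℱ k ≤ ℱ (k + 1) := ℱ.mono (Nat.le_succ k)
        have hpair := ((ih k le_rfl).map₂ (hdelay k ih) Prod.mk).mono hle
        have := hpair.map₂ (hact.isSimple_act k) fun p i =>
          p.1 - η k • (Pi.single i (S p.2 i) : Fin n → E)
        rwa [show x (k + 1) = _ from funext (hx k)]
  exact ⟨hiter k k le_rfl, hdelay k (hiter k)⟩

/-- **Convergence of asynchronous block iterations.** Let `S = 1 - T` for an operator `T`, and let
`B` be an inner product. If `B (S x) (x - y)` controls `θ / 2` times the square norm of `S x`, and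
`θ / 2` times the sum of the square norms of its blocks, with a margin, for all fixed points `y` of
`T`, then the iteration which moves one uniformly random block at a time, using information
delayed by at most `χ`, with steps at most `θ / (1 + 2 χ / √n)`, converges almost surely to a fixed
point. -/
theorem ae_tendsto_zero_of_async [IsProbabilityMeasure Pr] [FiniteDimensional ℝ E] (hn : 0 < n)
    (hact : IsUniformActivation Pr ℱ act τ) {χ : ℕ} (hτ : ∀ k j ω, τ k j ω ≤ χ)
    {B : LinearMap.BilinForm ℝ (Fin n → E)} (hsymm : ∀ x y, B x y = B y x)
    {κ : ℝ} (hκ : 0 < κ) (hB : ∀ x, κ * ‖x‖ ^ 2 ≤ B x x)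
    {S : (Fin n → E) → Fin n → E} (hS : Continuous S) (hzero : ∃ y, S y = 0)
    {θ ε : ℝ} (hε : 0 < ε)
    (hA : ∀ x y, S y = 0 → θ * B (S x) (S x) + ε * ‖S x‖ ^ 2 ≤ 2 * B (S x) (x - y))
    (hD : ∀ x y, S y = 0 → θ * ∑ i, B (Pi.single i (S x i) : Fin n → E) (Pi.single i (S x i))
      + ε * ‖S x‖ ^ 2 ≤ 2 * B (S x) (x - y))
    {η : ℕ → ℝ} {ηmin : ℝ} (hηmin : 0 < ηmin) (hη_lower : ∀ k, ηmin ≤ η k)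
    (hη_upper : ∀ k, η k * (1 + 2 * (χ / √n)) ≤ θ)
    {x : ℕ → Ω → Fin n → E} {x0 : Fin n → E} (h0 : ∀ ω, x 0 ω = x0)
    (hx : ∀ k ω, x (k + 1) ω = x k ω
      - η k • (Pi.single (act k ω) (S (fun j => x (k - τ k j ω) ω j) (act k ω)) : Fin n → E)) :
    ∀ᵐ ω ∂Pr, ∃ y, S y = 0 ∧ Tendsto (fun k => x k ω) atTop (𝓝 y) := by
  have hn' : (0 : ℝ) < n := by exact_mod_cast hn
  have hpos : ∀ v, 0 ≤ B v v := fun v => (by positivity : 0 ≤ κ * ‖v‖ ^ 2).trans (hB v)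
  have hη0 : ∀ k, 0 ≤ η k := fun k => hηmin.le.trans (hη_lower k)
  set ρ : ℝ := (√n)⁻¹ with hρ
  have hρ0 : 0 ≤ ρ := by positivity
  set xh : ℕ → Ω → Fin n → E := fun k ω j => x (k - τ k j ω) ω j with hxh
  set δ : ℕ → Ω → Fin n → E := fun l ω => x (l + 1) ω - x l ω with hδ
  have hxs := fun k => (isSimple_iterates hact hτ h0 hx k).1
  have hxhs : ∀ k, IsSimple (ℱ k) (xh k) := fun k => (isSimple_iterates hact hτ h0 hx k).2
  have hδs : ∀ l, IsSimple (ℱ (l + 1)) (δ l) := fun l =>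
    (hxs (l + 1)).map₂ ((hxs l).mono (ℱ.mono (Nat.le_succ l))) fun a b => a - b
  have hδeq : ∀ l ω, δ l ω = -(η l • (Pi.single (act l ω) (S (xh l ω) (act l ω)) : Fin n → E)) := by
    intro l ω
    simp only [hδ, hx l ω]
    abel
  have hidle : ∀ ω l j, j ≠ act l ω → x (l + 1) ω j = x l ω j := by
    intro ω l j hj
    rw [hx l ω]
    simp [hj]
  -- the delayed state differs from the current one by a subset of the increments in the window
  have hdiff : ∀ k ω, ∃ J ⊆ window χ k, x k ω = xh k ω + ∑ l ∈ J, δ l ω := by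
    intro k ω
    refine ⟨(Finset.range k).filter fun l => k ≤ l + τ k (act l ω) ω, ?_,
      eq_delayed_add_sum (x := fun l => x l ω) (act := fun l => act l ω) (hidle ω) k
        fun j => τ k j ω⟩
    intro l hl
    simp only [window, Finset.mem_filter] at *
    have := hτ k (act l ω) ω
    exact ⟨hl.1, by omega⟩
  -- the Lyapunov function of the distance to `y`, and the guaranteed decrease
  set V : (Fin n → E) → ℕ → Ω → ℝ := fun y k ω => B (x k ω - y) (x k ω - y)
    + ρ * ∑ l ∈ Finset.range k, ((l + χ + 1 - k : ℕ) : ℝ) * B (δ l ω) (δ l ω) with hV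
  set u : ℕ → Ω → ℝ := fun k ω => ηmin / n * (ε * ‖S (xh k ω)‖ ^ 2) with hu
  have hus : ∀ k, IsSimple (ℱ k) (u k) := fun k =>
    (hxhs k).comp fun v => ηmin / n * (ε * ‖S v‖ ^ 2)
  have hpast : ∀ (k : ℕ) (c : ℕ → ℝ), IsSimple (ℱ k) fun ω =>
      ρ * ∑ l ∈ Finset.range k, c l * B (δ l ω) (δ l ω) := by
    intro k c
    have h : IsSimple (ℱ k) fun ω => ∑ l ∈ Finset.range k, c l * B (δ l ω) (δ l ω) :=
      .finset_sum fun l hl => ((hδs l).mono (ℱ.mono (Finset.mem_range.1 hl))).comp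
        fun v => c l * B v v
    exact h.comp fun a => ρ * a
  have hVs : ∀ y k, IsSimple (ℱ k) (V y k) := fun y k =>
    ((hxs k).comp fun v => B (v - y) (v - y)).map₂ (hpast k _) (· + ·)
  have hV0 : ∀ y k ω, 0 ≤ V y k ω := fun y k ω => by
    have : 0 ≤ ∑ l ∈ Finset.range k, ((l + χ + 1 - k : ℕ) : ℝ) * B (δ l ω) (δ l ω) :=
      Finset.sum_nonneg fun l _ => mul_nonneg (Nat.cast_nonneg _) (hpos _)
    exact add_nonneg (hpos _) (mul_nonneg hρ0 this)
  have hu0 : ∀ k ω, 0 ≤ u k ω := fun k ω => by positivity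
  have hdec : ∀ y, S y = 0 → ∀ k, Pr[V y (k + 1) | ℱ k] ≤ᵐ[Pr] fun ω => V y k ω - u k ω := by
    intro y hy k
    set U : Fin n → Ω → Fin n → E := fun i ω => Pi.single i (S (xh k ω) i) with hU
    set F : Fin n → Ω → ℝ := fun i ω =>
      (B (x k ω - η k • U i ω - y) (x k ω - η k • U i ω - y)
        + ρ * (χ * B (η k • U i ω) (η k • U i ω)))
      + ρ * ∑ l ∈ Finset.range k, ((l + χ - k : ℕ) : ℝ) * B (δ l ω) (δ l ω) with hF
    have hFs : ∀ i, IsSimple (ℱ k) (F i) := by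
      intro i
      refine IsSimple.map₂ ?_ (hpast k _) (· + ·)
      exact (hxs k).map₂ (hxhs k) fun a b =>
        let v : Fin n → E := η k • (Pi.single i (S b i) : Fin n → E)
        B (a - v - y) (a - v - y) + ρ * (χ * B v v)
    have hVF : V y (k + 1) = fun ω => F (act k ω) ω := by
      funext ω
      have hlast : B (δ k ω) (δ k ω) = B (η k • U (act k ω) ω) (η k • U (act k ω) ω) := by
        rw [hδeq, map_neg, map_neg, LinearMap.neg_apply, neg_neg]
      have h1 : ∀ l, l + χ + 1 - (k + 1) = l + χ - k := fun l => by omega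
      simp only [hV, hF, Finset.sum_range_succ, h1, hlast, Nat.add_sub_cancel_left]
      rw [hx k ω]
      ring
    rw [hVF]
    filter_upwards [hact.condExp_act k hFs] with ω hω
    rw [hω]
    obtain ⟨J, hJ, hxJ⟩ := hdiff k ω
    have hstep := average_step_le hsymm hpos hn (U := fun i => U i ω)
      (Finset.univ_sum_single (S (xh k ω))) hJ (card_window_le χ k) hxJ (hη0 k)
      (hη_upper k) (hA (xh k ω) y hy) (hD (xh k ω) y hy)
    have hwin : ∑ l ∈ Finset.range k, ((l + χ + 1 - k : ℕ) : ℝ) * B (δ l ω) (δ l ω)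
        = ∑ l ∈ Finset.range k, ((l + χ - k : ℕ) : ℝ) * B (δ l ω) (δ l ω)
          + ∑ l ∈ window χ k, B (δ l ω) (δ l ω) := by
      rw [window, Finset.sum_filter, ← Finset.sum_add_distrib]
      refine Finset.sum_congr rfl fun l _ => ?_
      split_ifs with h
      · rw [show l + χ + 1 - k = (l + χ - k) + 1 by omega]
        push_cast
        ring
      · rw [show l + χ + 1 - k = l + χ - k by omega, add_zero]
    have huη : u k ω ≤ η k / n * (ε * ‖S (xh k ω)‖ ^ 2) := by
      have := hη_lower k
      simp only [hu]
      gcongr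
    have hconst : (n : ℝ)⁻¹ * ∑ i, F i ω
        = (n : ℝ)⁻¹ * ∑ i, (B (x k ω - η k • U i ω - y) (x k ω - η k • U i ω - y)
          + ρ * (χ * B (η k • U i ω) (η k • U i ω)))
          + ρ * ∑ l ∈ Finset.range k, ((l + χ - k : ℕ) : ℝ) * B (δ l ω) (δ l ω) := by
      simp only [hF]
      rw [Finset.sum_add_distrib, mul_add, Finset.sum_const, Finset.card_univ, Fintype.card_fin,
        nsmul_eq_mul, inv_mul_cancel_left₀ hn'.ne']
    rw [hconst]
    simp only [hV]
    rw [hwin, mul_add]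
    linarith
  obtain ⟨D, hDZ, hDc, hDd⟩ :=
    (TopologicalSpace.IsSeparable.of_separableSpace {y | S y = 0}).exists_countable_dense_subset
  have hDne : D.Nonempty := by
    obtain ⟨y, hy⟩ := hzero
    exact closure_nonempty_iff.1 ⟨y, hDd hy⟩
  have hall : ∀ᵐ ω ∂Pr, ∀ y ∈ D, Summable (fun k => u k ω) ∧
      ∃ c, Tendsto (fun k => V y k ω) atTop (𝓝 c) := by
    rw [ae_ball_iff hDc]
    exact fun y hy => ae_summable_and_tendsto (hVs y) hus (hV0 y) hu0 (hdec y (hDZ hy))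
  filter_upwards [hall] with ω hω
  have hBc : Continuous fun v => B v v := by
    have h : Continuous fun v => B.toContinuousBilinearMap v v := by fun_prop
    exact h
  have hsum : Summable fun k => u k ω := (hω _ hDne.some_mem).1
  have hres : Tendsto (fun k => S (xh k ω)) atTop (𝓝 0) := by
    rw [tendsto_zero_iff_norm_tendsto_zero]
    have h1 := (hsum.tendsto_atTop_zero.const_mul (ηmin / n * ε)⁻¹).sqrt
    simp only [mul_zero, Real.sqrt_zero] at h1
    refine h1.congr fun k => ?_
    have hne : ηmin / n * ε ≠ 0 := by positivity
    have hueq : u k ω = ηmin / n * ε * ‖S (xh k ω)‖ ^ 2 := (mul_assoc _ _ _).symm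
    rw [hueq, inv_mul_cancel_left₀ hne, Real.sqrt_sq (norm_nonneg _)]
  have hδ0 : Tendsto (fun l => δ l ω) atTop (𝓝 0) := by
    rw [tendsto_zero_iff_norm_tendsto_zero]
    refine squeeze_zero (fun l => norm_nonneg _) (fun l => ?_)
      (by simpa using hres.norm.const_mul θ)
    rw [hδeq, norm_neg, norm_smul, Real.norm_of_nonneg (hη0 l), Pi.norm_single]
    have hθ : η l ≤ θ := by
      have h1 := hη_upper l
      have h2 : 0 ≤ η l * (2 * (χ / √n)) := mul_nonneg (hη0 l) (by positivity)
      linarith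
    exact mul_le_mul hθ (norm_le_pi_norm _ _) (norm_nonneg _) ((hη0 l).trans hθ)
  have hBδ : Tendsto (fun l => B (δ l ω) (δ l ω)) atTop (𝓝 0) := by
    have h : Tendsto (fun l => B (δ l ω) (δ l ω)) atTop (𝓝 (B 0 0)) := (hBc.tendsto 0).comp hδ0
    rwa [map_zero] at h
  refine exists_tendsto_zero_of_fejer hsymm hκ hB hS hDne hDd (xh := fun k => xh k ω) ?_ ?_ hres
  · intro y hy
    obtain ⟨c, hc⟩ := (hω y hy).2
    have hmem : Tendsto (fun k => ρ * ∑ l ∈ Finset.range k,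
        ((l + χ + 1 - k : ℕ) : ℝ) * B (δ l ω) (δ l ω)) atTop (𝓝 0) := by
      refine squeeze_zero (fun k => mul_nonneg hρ0 (Finset.sum_nonneg fun l _ =>
        mul_nonneg (Nat.cast_nonneg _) (hpos _))) (fun k => ?_)
        (by simpa using (tendsto_sum_window χ hBδ fun l => hpos _).const_mul (ρ * χ))
      rw [mul_assoc]
      refine mul_le_mul_of_nonneg_left ?_ hρ0
      rw [window, Finset.sum_filter, Finset.mul_sum]
      refine Finset.sum_le_sum fun l hl => ?_
      have hl' := Finset.mem_range.1 hl
      split_ifs with h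
      · have : ((l + χ + 1 - k : ℕ) : ℝ) ≤ χ := by
          exact_mod_cast (by omega : l + χ + 1 - k ≤ χ)
        exact mul_le_mul_of_nonneg_right this (hpos _)
      · rw [show l + χ + 1 - k = 0 by omega]
        simp
    refine ⟨c, ?_⟩
    have := hc.sub hmem
    simp only [hV, sub_zero] at this
    simpa using this
  · rw [tendsto_zero_iff_norm_tendsto_zero]
    refine squeeze_zero (fun l => norm_nonneg _) (fun k => ?_)
      (tendsto_sum_window χ (tendsto_zero_iff_norm_tendsto_zero.1 hδ0) fun l => norm_nonneg _)
    obtain ⟨J, hJ, hxJ⟩ := hdiff k ω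
    rw [hxJ, add_sub_cancel_left]
    exact (norm_sum_le _ _).trans
      (Finset.sum_le_sum_of_subset_of_nonneg hJ fun l _ _ => norm_nonneg _)

end Async

/-! ### The graph Laplacian -/

section Laplacian

open Matrix

/-- The Rayleigh quotient of a real symmetric matrix is at most its largest eigenvalue. -/
theorem dotProduct_mulVec_le_sSup_spectrum {ι : Type*} [Fintype ι] [DecidableEq ι]
    {A : Matrix ι ι ℝ} (hA : A.IsHermitian) (x : ι → ℝ) :
    x ⬝ᵥ A *ᵥ x ≤ sSup (spectrum ℝ A) * (x ⬝ᵥ x) := by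
  set U : Matrix ι ι ℝ := hA.eigenvectorUnitary.1 with hU
  set y : ι → ℝ := Uᵀ *ᵥ x with hy
  have hstar : star U = Uᵀ := by
    rw [star_eq_conjTranspose, conjTranspose_eq_transpose_of_trivial]
  have hUU : U * Uᵀ = 1 := by
    rw [← hstar]
    exact Unitary.coe_mul_star_self hA.eigenvectorUnitary
  have hspec : A = U * diagonal hA.eigenvalues * Uᵀ := by
    have h := hA.spectral_theorem
    rw [Unitary.conjStarAlgAut_apply] at h
    rw [← hstar]
    exact h
  have h1 : x ⬝ᵥ A *ᵥ x = ∑ i, hA.eigenvalues i * (y i * y i) := by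
    have h : A *ᵥ x = U *ᵥ diagonal hA.eigenvalues *ᵥ y := by
      rw [hy, mulVec_mulVec, mulVec_mulVec, ← hspec]
    rw [h, dotProduct_mulVec, ← mulVec_transpose, ← hy, dotProduct]
    refine Finset.sum_congr rfl fun i _ => ?_
    rw [mulVec_diagonal]
    ring
  have h2 : x ⬝ᵥ x = ∑ i, y i * y i := by
    calc x ⬝ᵥ x = x ⬝ᵥ (U * Uᵀ) *ᵥ x := by rw [hUU, one_mulVec]
      _ = y ⬝ᵥ y := by rw [← mulVec_mulVec, dotProduct_mulVec, ← mulVec_transpose]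
      _ = ∑ i, y i * y i := rfl
  rw [h1, h2, Finset.mul_sum]
  refine Finset.sum_le_sum fun i _ => mul_le_mul_of_nonneg_right ?_ (mul_self_nonneg _)
  exact le_csSup (Matrix.finite_real_spectrum (A := A)).bddAbove
    (hA.eigenvalues_mem_spectrum_real i)

/-- In a connected graph, an edge leaves every proper nonempty set of vertices. -/
theorem exists_adj_of_connected {n : ℕ} {G : SimpleGraph (Fin n)} (hG : G.Connected)
    {s : Set (Fin n)} {a b : Fin n} (ha : a ∈ s) (hb : b ∉ s) : ∃ u ∈ s, ∃ v ∉ s, G.Adj u v := by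
  obtain ⟨p⟩ := hG.preconnected a b
  obtain ⟨d, -, h1, h2⟩ := p.exists_boundary_dart s ha hb
  exact ⟨d.fst, h1, d.snd, h2, d.adj⟩

theorem exists_notMem_of_card_lt {n : ℕ} {s : Finset (Fin n)} (hs : s.card < n) : ∃ b, b ∉ s := by
  by_contra! h
  rw [Finset.eq_univ_of_forall h, Finset.card_univ, Fintype.card_fin] at hs
  exact lt_irrefl _ hs

/-- A connected graph with at least three vertices has a path with two edges. -/
theorem exists_path_two {n : ℕ} {G : SimpleGraph (Fin n)} (hG : G.Connected) (hn : 3 ≤ n) :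
    ∃ a b c, G.Adj a b ∧ G.Adj b c ∧ a ≠ c := by
  have hone : ∀ a : Fin n, ∃ b, b ∉ ({a} : Finset (Fin n)) := fun a =>
    exists_notMem_of_card_lt (by rw [Finset.card_singleton]; omega)
  obtain ⟨b, hb⟩ := hone ⟨0, by omega⟩
  obtain ⟨u, -, v, -, huv⟩ := exists_adj_of_connected hG
    (Finset.mem_coe.2 (Finset.mem_singleton_self _)) (Finset.mem_coe.not.2 hb)
  obtain ⟨w, hw⟩ := exists_notMem_of_card_lt (s := {u, v})
    (Finset.card_le_two.trans_lt (by omega))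
  obtain ⟨y, hy, z, hz, hyz⟩ := exists_adj_of_connected hG
    (s := (({u, v} : Finset (Fin n)) : Set _)) (a := u) (by simp) (Finset.mem_coe.not.2 hw)
  simp only [Finset.coe_insert, Finset.coe_singleton, Set.mem_insert_iff,
    Set.mem_singleton_iff, not_or] at hy hz
  rcases hy with rfl | rfl
  · exact ⟨v, y, z, huv.symm, hyz, fun h => hz.2 h.symm⟩
  · exact ⟨u, y, z, huv, hyz, fun h => hz.1 h.symm⟩

variable {n : ℕ} (G : SimpleGraph (Fin n)) [DecidableRel G.Adj]

theorem neighborDiff_eq_mulVec (x : Fin n → ℝ) : neighborDiff G x = G.lapMatrix ℝ *ᵥ x := by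
  funext i
  rw [SimpleGraph.lapMatrix_mulVec_apply, neighborDiff, Finset.sum_sub_distrib, Finset.sum_const,
    SimpleGraph.card_neighborFinset_eq_degree, nsmul_eq_mul]

theorem dotProduct_lapMatrix_comm (x y : Fin n → ℝ) :
    x ⬝ᵥ G.lapMatrix ℝ *ᵥ y = y ⬝ᵥ G.lapMatrix ℝ *ᵥ x := by
  rw [dotProduct_mulVec, ← mulVec_transpose, (G.isSymm_lapMatrix (R := ℝ)).eq, dotProduct_comm]

theorem dotProduct_lapMatrix_self (x : Fin n → ℝ) :
    x ⬝ᵥ G.lapMatrix ℝ *ᵥ x = (∑ i, ∑ j, if G.Adj i j then (x i - x j) ^ 2 else 0) / 2 := by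
  rw [← SimpleGraph.lapMatrix_toLinearMap₂' ℝ G x, toLinearMap₂'_apply']

theorem dotProduct_lapMatrix_self_nonneg (x : Fin n → ℝ) : 0 ≤ x ⬝ᵥ G.lapMatrix ℝ *ᵥ x := by
  rw [dotProduct_lapMatrix_self]
  positivity

theorem dotProduct_lapMatrix_self_le (x : Fin n → ℝ) :
    x ⬝ᵥ G.lapMatrix ℝ *ᵥ x ≤ maxLaplacianEigenvalue G * (x ⬝ᵥ x) :=
  dotProduct_mulVec_le_sSup_spectrum (G.isHermitian_lapMatrix ℝ) x

/-- The Laplacian form is at least the sum of the squared differences along any family of edges,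
listed without repetition up to orientation. -/
theorem sum_sq_edges_le (F : Finset (Fin n × Fin n)) (hF : ∀ e ∈ F, G.Adj e.1 e.2)
    (hswap : ∀ e ∈ F, e.swap ∉ F) (x : Fin n → ℝ) :
    ∑ e ∈ F, (x e.1 - x e.2) ^ 2 ≤ x ⬝ᵥ G.lapMatrix ℝ *ᵥ x := by
  set f : Fin n × Fin n → ℝ := fun e => if G.Adj e.1 e.2 then (x e.1 - x e.2) ^ 2 else 0 with hf
  have h0 : ∀ e, 0 ≤ f e := fun e => by simp only [hf]; positivity
  have h1 : ∑ e ∈ F, f e = ∑ e ∈ F, (x e.1 - x e.2) ^ 2 :=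
    Finset.sum_congr rfl fun e he => if_pos (hF e he)
  have h2 : ∑ e ∈ F.map ⟨Prod.swap, Prod.swap_injective⟩, f e = ∑ e ∈ F, (x e.1 - x e.2) ^ 2 := by
    rw [Finset.sum_map]
    refine Finset.sum_congr rfl fun e he => ?_
    simp only [hf, Function.Embedding.coeFn_mk, Prod.fst_swap, Prod.snd_swap]
    rw [if_pos (hF e he).symm]
    ring
  have hdisj : Disjoint F (F.map ⟨Prod.swap, Prod.swap_injective⟩) := by
    rw [Finset.disjoint_left]
    intro e he he'
    obtain ⟨e', he1, rfl⟩ := Finset.mem_map.1 he'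
    exact hswap e' he1 he
  have h3 : ∑ e ∈ F.disjUnion _ hdisj, f e ≤ ∑ e, f e :=
    Finset.sum_le_sum_of_subset_of_nonneg (Finset.subset_univ _) fun e _ _ => h0 e
  rw [Finset.sum_disjUnion, h1, h2, Fintype.sum_prod_type] at h3
  rw [dotProduct_lapMatrix_self]
  linarith

/-- The star around `i` gives a lower bound for the largest Laplacian eigenvalue. -/
theorem degree_add_one_le_maxLaplacianEigenvalue (i : Fin n) (hi : 0 < G.degree i) :
    (G.degree i : ℝ) + 1 ≤ maxLaplacianEigenvalue G := by
  set d : ℝ := ((G.degree i : ℕ) : ℝ) with hd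
  have hd0 : 0 < d := Nat.cast_pos.2 hi
  -- the eigenvector of the star for its largest eigenvalue `d + 1`
  set x : Fin n → ℝ := fun j => if j = i then d else if G.Adj i j then -1 else 0 with hx
  have hxi : x i = d := by simp [hx]
  have hxj : ∀ j ∈ G.neighborFinset i, x j = -1 := fun j hj => by
    have hadj := (G.mem_neighborFinset i j).1 hj
    simp [hx, hadj, hadj.ne']
  have hcard : ((G.neighborFinset i).card : ℝ) = d := by
    rw [SimpleGraph.card_neighborFinset_eq_degree]
  have hlow := sum_sq_edges_le G ({i} ×ˢ G.neighborFinset i) (by simp) (by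
    rintro ⟨a, b⟩ h1 h2
    simp only [Finset.mem_product, Finset.mem_singleton, SimpleGraph.mem_neighborFinset,
      Prod.fst_swap, Prod.snd_swap] at h1 h2
    rw [h2.1] at h1
    exact G.loopless.irrefl _ h1.2) x
  rw [Finset.sum_product, Finset.sum_singleton] at hlow
  rw [Finset.sum_congr rfl fun j hj => by rw [hxi, hxj j hj], Finset.sum_const, nsmul_eq_mul,
    hcard] at hlow
  have hnorm : x ⬝ᵥ x = d ^ 2 + d := by
    have h1 : ∀ j, x j * x j = (if j = i then d ^ 2 else 0)
        + if j ∈ G.neighborFinset i then 1 else 0 := by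
      intro j
      simp only [G.mem_neighborFinset]
      by_cases hji : j = i
      · subst hji
        simp [hx, sq]
      · by_cases hadj : G.Adj i j <;> simp [hx, hji, hadj]
    rw [dotProduct, Finset.sum_congr rfl fun j _ => h1 j, Finset.sum_add_distrib,
      Finset.sum_ite_eq', if_pos (Finset.mem_univ i), Finset.sum_ite_mem, Finset.univ_inter,
      Finset.sum_const, nsmul_eq_mul, hcard, mul_one]
  have hup := dotProduct_lapMatrix_self_le G x
  rw [hnorm] at hup
  have hpos : 0 < d ^ 2 + d := by positivity
  refine le_of_mul_le_mul_right ?_ hpos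
  nlinarith

/-- A path with three edges gives a lower bound for the largest Laplacian eigenvalue. -/
theorem le_maxLaplacianEigenvalue_of_path {a b c d : Fin n} (hab : G.Adj a b) (hbc : G.Adj b c)
    (hcd : G.Adj c d) (hac : a ≠ c) (hbd : b ≠ d) (had : a ≠ d) :
    17 / 5 ≤ maxLaplacianEigenvalue G := by
  have h1 := hab.ne
  have h2 := hbc.ne
  have h3 := hcd.ne
  -- an approximate eigenvector for the largest eigenvalue `2 + √2` of the path
  set x : Fin n → ℝ := Pi.single a 1 + Pi.single b (-2) + Pi.single c 2 + Pi.single d (-1) with hx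
  have hxa : x a = 1 := by simp [hx, h1, hac, had]
  have hxb : x b = -2 := by simp [hx, h1.symm, h2, hbd]
  have hxc : x c = 2 := by simp [hx, hac.symm, h2.symm, h3]
  have hxd : x d = -1 := by simp [hx, had.symm, hbd.symm, h3.symm]
  have hlow := sum_sq_edges_le G {(a, b), (b, c), (c, d)} (by simp [hab, hbc, hcd])
    (by simp [Prod.ext_iff]; grind) x
  rw [Finset.sum_insert (by simp [Prod.ext_iff]; grind),
    Finset.sum_insert (by simp [Prod.ext_iff]; grind), Finset.sum_singleton] at hlow
  simp only [hxa, hxb, hxc, hxd] at hlow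
  have hnorm : x ⬝ᵥ x = 10 := by
    calc x ⬝ᵥ x = (Pi.single a 1 + Pi.single b (-2) + Pi.single c 2 + Pi.single d (-1)) ⬝ᵥ x := by
          rw [← hx]
      _ = 10 := ?_
    simp only [add_dotProduct, single_dotProduct, hxa, hxb, hxc, hxd]
    norm_num
  have hup := dotProduct_lapMatrix_self_le G x
  rw [hnorm] at hup
  linarith

/-- Schur's test for the adjacency matrix. -/
theorem adjMatrix_mulVec_sq_le {Δ : ℝ} (hΔ : ∀ i, (G.degree i : ℝ) ≤ Δ) (hΔ0 : 0 ≤ Δ)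
    (x : Fin n → ℝ) :
    (G.adjMatrix ℝ *ᵥ x) ⬝ᵥ (G.adjMatrix ℝ *ᵥ x) ≤ Δ ^ 2 * (x ⬝ᵥ x) := by
  have h1 : ∀ i, (G.adjMatrix ℝ *ᵥ x) i * (G.adjMatrix ℝ *ᵥ x) i
      ≤ Δ * ∑ j, if G.Adj i j then x j ^ 2 else 0 := by
    intro i
    rw [SimpleGraph.adjMatrix_mulVec_apply, ← sq, ← Finset.sum_filter, ← G.neighborFinset_eq_filter]
    refine (sq_sum_le_card_mul_sum_sq).trans ?_
    rw [SimpleGraph.card_neighborFinset_eq_degree]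
    exact mul_le_mul_of_nonneg_right (hΔ i) (Finset.sum_nonneg fun j _ => sq_nonneg _)
  have h2 : ∀ j, (∑ i, if G.Adj i j then x j ^ 2 else 0) ≤ Δ * (x j * x j) := by
    intro j
    rw [← Finset.sum_filter, Finset.sum_const, nsmul_eq_mul, ← sq]
    refine mul_le_mul_of_nonneg_right (le_trans (le_of_eq ?_) (hΔ j)) (sq_nonneg _)
    rw [← SimpleGraph.card_neighborFinset_eq_degree, G.neighborFinset_eq_filter]
    simp only [G.adj_comm]
  calc (G.adjMatrix ℝ *ᵥ x) ⬝ᵥ (G.adjMatrix ℝ *ᵥ x)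
      ≤ ∑ i, Δ * ∑ j, (if G.Adj i j then x j ^ 2 else 0) := Finset.sum_le_sum fun i _ => h1 i
    _ = Δ * ∑ j, ∑ i, (if G.Adj i j then x j ^ 2 else 0) := by
      rw [← Finset.mul_sum, Finset.sum_comm]
    _ ≤ Δ * ∑ j, Δ * (x j * x j) :=
      mul_le_mul_of_nonneg_left (Finset.sum_le_sum fun j _ => h2 j) hΔ0
    _ = Δ ^ 2 * (x ⬝ᵥ x) := by rw [← Finset.mul_sum, dotProduct]; ring

variable {G}

theorem two_le_degree_of_adj {a b c : Fin n} (hab : G.Adj a b) (hbc : G.Adj b c) (hac : a ≠ c) :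
    2 ≤ G.degree b := by
  rw [← SimpleGraph.card_neighborFinset_eq_degree, ← Finset.card_pair hac]
  refine Finset.card_le_card ?_
  intro v hv
  rw [G.mem_neighborFinset]
  rcases Finset.mem_insert.1 hv with rfl | h
  · exact hab.symm
  · rw [Finset.mem_singleton.1 h]; exact hbc

theorem three_le_maxLaplacianEigenvalue (hG : G.Connected) (hn : 3 ≤ n) :
    3 ≤ maxLaplacianEigenvalue G := by
  obtain ⟨a, b, c, hab, hbc, hac⟩ := exists_path_two hG hn
  have h2 := two_le_degree_of_adj hab hbc hac
  have h := degree_add_one_le_maxLaplacianEigenvalue G b (by omega)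
  have : (2 : ℝ) ≤ G.degree b := by exact_mod_cast h2
  linarith

/-- A connected graph with at least four vertices contains a star or a path with three edges. -/
theorem le_maxLaplacianEigenvalue_of_four_le (hG : G.Connected) (hn : 4 ≤ n) :
    17 / 5 ≤ maxLaplacianEigenvalue G := by
  obtain ⟨a, b, c, hab, hbc, hac⟩ := exists_path_two hG (by omega)
  obtain ⟨w, hw⟩ := exists_notMem_of_card_lt (s := {a, b, c})
    (Finset.card_le_three.trans_lt (by omega))
  obtain ⟨y, hy, z, hz, hyz⟩ := exists_adj_of_connected hG
    (s := (({a, b, c} : Finset (Fin n)) : Set _)) (a := a) (by simp) (Finset.mem_coe.not.2 hw)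
  simp only [Finset.coe_insert, Finset.coe_singleton, Set.mem_insert_iff,
    Set.mem_singleton_iff, not_or] at hy hz
  obtain ⟨hza, hzb, hzc⟩ := hz
  rcases hy with rfl | rfl | rfl
  · exact le_maxLaplacianEigenvalue_of_path G hyz.symm hab hbc hzb hac hzc
  · have h3 : 3 ≤ G.degree y := by
      rw [← SimpleGraph.card_neighborFinset_eq_degree,
        ← Finset.card_eq_three.2 ⟨a, c, z, hac, Ne.symm hza, Ne.symm hzc, rfl⟩]
      refine Finset.card_le_card ?_
      intro v hv
      rw [G.mem_neighborFinset]
      simp only [Finset.mem_insert, Finset.mem_singleton] at hv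
      rcases hv with rfl | rfl | rfl
      exacts [hab.symm, hbc, hyz]
    have h := degree_add_one_le_maxLaplacianEigenvalue G y (by omega)
    have : (3 : ℝ) ≤ G.degree y := by exact_mod_cast h3
    linarith
  · exact le_maxLaplacianEigenvalue_of_path G hab hbc hyz hac (Ne.symm hzb) (Ne.symm hza)

theorem degree_pos_of_connected (hG : G.Connected) (hn : 2 ≤ n) (i : Fin n) : 0 < G.degree i := by
  obtain ⟨b, hb⟩ := exists_notMem_of_card_lt (s := {i}) (by rw [Finset.card_singleton]; omega)
  obtain ⟨u, hu, v, -, huv⟩ := exists_adj_of_connected hG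
    (Finset.mem_coe.2 (Finset.mem_singleton_self i)) (Finset.mem_coe.not.2 hb)
  rw [Finset.mem_coe, Finset.mem_singleton] at hu
  rw [SimpleGraph.degree_pos_iff_exists_adj]
  exact ⟨v, hu ▸ huv⟩

theorem two_le_maxLaplacianEigenvalue (hG : G.Connected) (hn : 2 ≤ n) :
    2 ≤ maxLaplacianEigenvalue G := by
  have h0 := degree_pos_of_connected hG hn ⟨0, by omega⟩
  have h := degree_add_one_le_maxLaplacianEigenvalue G _ h0
  have : (1 : ℝ) ≤ G.degree ⟨0, by omega⟩ := by exact_mod_cast h0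
  linarith

/-- The adjacency matrix, which couples different microgrids, is dominated by the slack
`c² - c L` of the cocoercivity constant, if there are at least three microgrids. -/
theorem adjMatrix_mulVec_sq_le_slack (hG : G.Connected) (hn : 3 ≤ n) {c : ℝ}
    (hc : maxLaplacianEigenvalue G ^ 2 ≤ c) (x : Fin n → ℝ) :
    16 * ((G.adjMatrix ℝ *ᵥ x) ⬝ᵥ (G.adjMatrix ℝ *ᵥ x))
      ≤ c * (c * (x ⬝ᵥ x) - x ⬝ᵥ G.lapMatrix ℝ *ᵥ x) := by
  set σ := maxLaplacianEigenvalue G with hσ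
  have hx0 : 0 ≤ x ⬝ᵥ x := by
    rw [dotProduct]; exact Finset.sum_nonneg fun i _ => mul_self_nonneg _
  have hLx := dotProduct_lapMatrix_self_le G x
  rw [← hσ] at hLx
  rcases Nat.lt_or_ge 3 n with h4 | h3
  · have hσ1 : 17 / 5 ≤ σ := le_maxLaplacianEigenvalue_of_four_le hG h4
    have hdeg : ∀ i, (G.degree i : ℝ) ≤ σ - 1 := fun i => by
      have := degree_add_one_le_maxLaplacianEigenvalue G i (degree_pos_of_connected hG (by omega) i)
      linarith
    have hA := adjMatrix_mulVec_sq_le G hdeg (by linarith) x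
    -- the bound `17 / 5` lies just above the largest root of `σ ^ 3 - 16 * σ + 16`
    have hpoly : 16 * (σ - 1) ^ 2 ≤ σ ^ 2 * (σ ^ 2 - σ) := by
      have h1 : 0 ≤ σ ^ 3 - 16 * σ + 16 := by
        nlinarith [mul_nonneg (sub_nonneg.2 hσ1) (sub_nonneg.2 hσ1),
          mul_nonneg (mul_nonneg (sub_nonneg.2 hσ1) (sub_nonneg.2 hσ1)) (by linarith : 0 ≤ σ)]
      nlinarith [mul_nonneg h1 (by linarith : 0 ≤ σ - 1)]
    have hcc : σ ^ 2 * (σ ^ 2 - σ) ≤ c * (c - σ) := by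
      refine mul_le_mul hc (by linarith) (by nlinarith) (by nlinarith)
    calc 16 * ((G.adjMatrix ℝ *ᵥ x) ⬝ᵥ (G.adjMatrix ℝ *ᵥ x))
        ≤ (16 * (σ - 1) ^ 2) * (x ⬝ᵥ x) := by linarith
      _ ≤ c * (c - σ) * (x ⬝ᵥ x) := mul_le_mul_of_nonneg_right (hpoly.trans hcc) hx0
      _ = c * (c * (x ⬝ᵥ x) - σ * (x ⬝ᵥ x)) := by ring
      _ ≤ _ := mul_le_mul_of_nonneg_left (by linarith) (by nlinarith)
  · obtain rfl : n = 3 := by omega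
    have hσ3 : 3 ≤ σ := three_le_maxLaplacianEigenvalue hG le_rfl
    have hc9 : 9 ≤ c := by nlinarith
    have hL3 : x ⬝ᵥ G.lapMatrix ℝ *ᵥ x ≤ c * (x ⬝ᵥ x) :=
      hLx.trans (mul_le_mul_of_nonneg_right (by nlinarith) hx0)
    suffices h : 16 * ((G.adjMatrix ℝ *ᵥ x) ⬝ᵥ (G.adjMatrix ℝ *ᵥ x))
        ≤ 9 * (9 * (x ⬝ᵥ x) - x ⬝ᵥ G.lapMatrix ℝ *ᵥ x) by
      have h1 : 9 * (9 * (x ⬝ᵥ x) - x ⬝ᵥ G.lapMatrix ℝ *ᵥ x)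
          ≤ 9 * (c * (x ⬝ᵥ x) - x ⬝ᵥ G.lapMatrix ℝ *ᵥ x) := by nlinarith
      have h2 := mul_le_mul_of_nonneg_right hc9 (sub_nonneg.2 hL3)
      linarith
    -- the three possible edges leave a few explicit ternary quadratic forms
    rw [dotProduct_lapMatrix_self]
    simp only [dotProduct, mulVec, Fin.sum_univ_three, SimpleGraph.adjMatrix_apply,
      SimpleGraph.irrefl, G.adj_comm 1 0, G.adj_comm 2 0, G.adj_comm 2 1]
    by_cases h01 : G.Adj 0 1 <;> by_cases h02 : G.Adj 0 2 <;> by_cases h12 : G.Adj 1 2 <;>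
      simp only [h01, h02, h12, if_true, if_false] <;>
      nlinarith [sq_nonneg (x 0 - x 1), sq_nonneg (x 0 - x 2), sq_nonneg (x 1 - x 2),
        sq_nonneg (x 0 + x 1), sq_nonneg (x 0 + x 2), sq_nonneg (x 1 + x 2), sq_nonneg (x 0),
        sq_nonneg (x 1), sq_nonneg (x 2)]

/-- On a connected graph, every vector with zero sum is in the range of the Laplacian. -/
theorem exists_lapMatrix_mulVec_eq (hG : G.Connected) {b : Fin n → ℝ} (hb : ∑ i, b i = 0) :
    ∃ z, G.lapMatrix ℝ *ᵥ z = b := by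
  set T := Matrix.toEuclideanLin (G.lapMatrix ℝ) with hT
  have hsymm : T.IsSymmetric := isSymmetric_toEuclideanLin_iff.2 (G.isHermitian_lapMatrix ℝ)
  have hmem : WithLp.toLp 2 b ∈ LinearMap.range T := by
    rw [← Submodule.orthogonal_orthogonal (LinearMap.range T), hsymm.orthogonal_range]
    rw [Submodule.mem_orthogonal]
    intro u hu
    have hu' : G.lapMatrix ℝ *ᵥ u.ofLp = 0 := by
      have := LinearMap.mem_ker.1 hu
      rw [hT, toLpLin_apply] at this
      simpa using this
    have hconst := (G.lapMatrix_mulVec_eq_zero_iff_forall_reachable).1 hu'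
    obtain ⟨i₀⟩ := hG.nonempty
    have hui : ∀ i, u.ofLp i = u.ofLp i₀ := fun i => hconst i i₀ (hG.preconnected i i₀)
    simp only [PiLp.inner_apply, RCLike.inner_apply, conj_trivial, hui, ← Finset.sum_mul, hb,
      zero_mul]
  obtain ⟨z, hz⟩ := hmem
  refine ⟨z.ofLp, ?_⟩
  rw [hT, toLpLin_apply] at hz
  exact congrArg WithLp.ofLp hz

end Laplacian

/-! ### The coupling between microgrids is dominated by the slack -/

section Slack

open Matrix

variable {n : ℕ} (G : SimpleGraph (Fin n)) [DecidableRel G.Adj]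

/-- The quadratic form of `Φ`, with diagonal blocks `gM`, `gZ`, `gP`. -/
noncomputable def phiForm (gM gZ gP : ℝ) (p z s : Fin n → ℝ) : ℝ :=
  gM * (p ⬝ᵥ p) + gZ * (z ⬝ᵥ z) + gP * (s ⬝ᵥ s) + 2 * (p ⬝ᵥ G.lapMatrix ℝ *ᵥ z) + 2 * (p ⬝ᵥ s)

theorem dotProduct_self_nonneg_real {ι : Type*} [Fintype ι] (x : ι → ℝ) : 0 ≤ x ⬝ᵥ x :=
  Finset.sum_nonneg fun _ _ => mul_self_nonneg _

theorem two_mul_dotProduct_le {ι : Type*} [Fintype ι] {t : ℝ} (ht : 0 < t) (x y : ι → ℝ) :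
    2 * (x ⬝ᵥ y) ≤ t * (x ⬝ᵥ x) + t⁻¹ * (y ⬝ᵥ y) := by
  have h := dotProduct_self_nonneg_real (t • x - y)
  simp only [sub_dotProduct, dotProduct_sub, smul_dotProduct, dotProduct_smul, smul_eq_mul,
    dotProduct_comm y x] at h
  have h2 := mul_nonneg (inv_nonneg.2 ht.le) h
  have h3 : t⁻¹ * (t * (t * (x ⬝ᵥ x)) - t * (x ⬝ᵥ y) - (t * (x ⬝ᵥ y) - y ⬝ᵥ y))
      = t * (x ⬝ᵥ x) - 2 * (x ⬝ᵥ y) + t⁻¹ * (y ⬝ᵥ y) := by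
    field_simp
    ring
  linarith

/-- Uniform positivity of a form in `p` and in the shifted vector `s + p / w`. -/
theorem exists_le_of_shift {ι : Type*} [Fintype ι] {α β : ℝ} (hα : 0 < α) (hβ : 0 < β) (w : ℝ) :
    ∃ ε > 0, ∀ p s : ι → ℝ,
      ε * (p ⬝ᵥ p + s ⬝ᵥ s) ≤ α * (p ⬝ᵥ p) + β * ((s + w⁻¹ • p) ⬝ᵥ (s + w⁻¹ • p)) := by
  refine ⟨min (α / (1 + 2 * w⁻¹ ^ 2)) (β / 2), by positivity, fun p s => ?_⟩
  set ε := min (α / (1 + 2 * w⁻¹ ^ 2)) (β / 2) with hε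
  have hε0 : 0 ≤ ε := by positivity
  have h1 : ε * (1 + 2 * w⁻¹ ^ 2) ≤ α := by
    rw [← le_div_iff₀ (by positivity)]; exact min_le_left _ _
  have h2 : 2 * ε ≤ β := by have := min_le_right (α / (1 + 2 * w⁻¹ ^ 2)) (β / 2); linarith
  set r := s + w⁻¹ • p with hr
  have hs : s = r - w⁻¹ • p := by rw [hr]; abel
  have hpp := dotProduct_self_nonneg_real p
  have hrr := dotProduct_self_nonneg_real r
  have hss : s ⬝ᵥ s ≤ 2 * (r ⬝ᵥ r) + 2 * w⁻¹ ^ 2 * (p ⬝ᵥ p) := by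
    have h := dotProduct_self_nonneg_real (r + w⁻¹ • p)
    rw [hs]
    simp only [sub_dotProduct, dotProduct_sub, add_dotProduct, dotProduct_add, smul_dotProduct,
      dotProduct_smul, smul_eq_mul, dotProduct_comm p r] at h ⊢
    linarith
  have h3 := mul_le_mul_of_nonneg_right h1 hpp
  have h4 := mul_le_mul_of_nonneg_right h2 hrr
  have h5 := mul_le_mul_of_nonneg_left hss hε0
  linarith

/-- A binary quadratic form with negative discriminant is uniformly positive. -/
theorem exists_le_of_discrim {a b c : ℝ} (ha : 0 < a) (hc : 0 < c) (h : b ^ 2 < 4 * a * c) :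
    ∃ ε > 0, ∀ x y : ℝ, ε * (x ^ 2 + y ^ 2) ≤ a * x ^ 2 + b * (x * y) + c * y ^ 2 := by
  refine ⟨(4 * a * c - b ^ 2) / (4 * (a + c)), div_pos (by linarith) (by positivity),
    fun x y => ?_⟩
  set ε := (4 * a * c - b ^ 2) / (4 * (a + c)) with hε
  have h1 : ε * (4 * (a + c)) = 4 * a * c - b ^ 2 := div_mul_cancel₀ _ (by positivity)
  have hlt : 0 < a - ε := by
    have : ε < a := by
      rw [hε, div_lt_iff₀ (by positivity)]
      nlinarith [sq_nonneg b, mul_pos ha ha]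
    linarith
  have h2 : b ^ 2 ≤ 4 * (a - ε) * (c - ε) := by nlinarith [sq_nonneg ε]
  have h3 : 0 ≤ (2 * (a - ε) * x + b * y) ^ 2 + (4 * (a - ε) * (c - ε) - b ^ 2) * y ^ 2 :=
    add_nonneg (sq_nonneg _) (mul_nonneg (by linarith) (sq_nonneg _))
  have h4 : (2 * (a - ε) * x + b * y) ^ 2 + (4 * (a - ε) * (c - ε) - b ^ 2) * y ^ 2
      = 4 * (a - ε) * ((a - ε) * x ^ 2 + b * (x * y) + (c - ε) * y ^ 2) := by ring
  rw [h4] at h3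
  have h5 := nonneg_of_mul_nonneg_right h3 (by linarith)
  linarith

/-- The bound `κ ≤ Φ`, in terms of the quadratic form. -/
structure PhiBound (κ gM gZ gP : ℝ) : Prop where
  le_form : ∀ p z s, κ * (p ⬝ᵥ p + z ⬝ᵥ z + s ⬝ᵥ s) ≤ phiForm G gM gZ gP p z s

variable {G} {κ gM gZ gP : ℝ}

/-- The identity blocks of `Φ` couple `p` and `s`, so its generation block exceeds `κ` strictly. -/
theorem PhiBound.kappa_lt (h : PhiBound G κ gM gZ gP) (hn : 0 < n) : κ < gP := by
  have hn' : (0 : ℝ) < n := by exact_mod_cast hn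
  have hone : (1 : Fin n → ℝ) ⬝ᵥ 1 = n := by simp [dotProduct]
  have hpt : ∀ t r : ℝ, 0 ≤ (gM - κ) * t ^ 2 + (gP - κ) * r ^ 2 + 2 * t * r := by
    intro t r
    have h1 := h.le_form (t • 1) 0 (r • 1)
    simp only [phiForm, smul_dotProduct, dotProduct_smul, hone, mulVec_zero, dotProduct_zero,
      smul_eq_mul] at h1
    have h2 : 0 ≤ n * ((gM - κ) * t ^ 2 + (gP - κ) * r ^ 2 + 2 * t * r) := by linarith
    exact nonneg_of_mul_nonneg_right h2 hn'
  have hM : 0 ≤ gM - κ := by simpa using hpt 1 0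
  have h3 := hpt (-1) (gM - κ + 1)
  by_contra! hle
  nlinarith [mul_nonneg (sub_nonneg.2 hle) (sq_nonneg (gM - κ + 1))]

/-- Completing the square in the generation block of `Φ - κ`. -/
theorem PhiBound.form_eq (h : PhiBound G κ gM gZ gP) (hn : 0 < n) (p z s : Fin n → ℝ) :
    phiForm G gM gZ gP p z s = κ * (p ⬝ᵥ p + z ⬝ᵥ z + s ⬝ᵥ s)
      + ((gM - κ - (gP - κ)⁻¹) * (p ⬝ᵥ p) + (gZ - κ) * (z ⬝ᵥ z)
        + 2 * (p ⬝ᵥ G.lapMatrix ℝ *ᵥ z))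
      + (gP - κ) * ((s + (gP - κ)⁻¹ • p) ⬝ᵥ (s + (gP - κ)⁻¹ • p)) := by
  have hw : gP - κ ≠ 0 := (sub_pos.2 (h.kappa_lt hn)).ne'
  simp only [phiForm, add_dotProduct, dotProduct_add, smul_dotProduct, dotProduct_smul,
    smul_eq_mul, dotProduct_comm s p]
  field_simp
  ring

/-- Positivity of the Schur complement of the generation block of `Φ - κ`. -/
theorem PhiBound.schur_nonneg (h : PhiBound G κ gM gZ gP) (hn : 0 < n) (p z : Fin n → ℝ) :
    0 ≤ (gM - κ - (gP - κ)⁻¹) * (p ⬝ᵥ p) + (gZ - κ) * (z ⬝ᵥ z)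
      + 2 * (p ⬝ᵥ G.lapMatrix ℝ *ᵥ z) := by
  -- the minimizer over `s` of the form of `Φ - κ`
  have h1 := h.le_form p z (-((gP - κ)⁻¹ • p))
  rw [h.form_eq hn, neg_add_cancel, dotProduct_zero] at h1
  linarith

theorem dotProduct_mul_le {c : ℝ} {a : Fin n → ℝ} (ha : ∀ i, a i ≤ c) (s : Fin n → ℝ) :
    s ⬝ᵥ (a * s) ≤ c * (s ⬝ᵥ s) := by
  simp only [dotProduct, Finset.mul_sum, Pi.mul_apply]
  refine Finset.sum_le_sum fun i _ => ?_
  nlinarith [mul_le_mul_of_nonneg_right (ha i) (mul_self_nonneg (s i))]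

variable (G) in
/-- What is left of the guaranteed decrease after `θ` times the square `Φ`-norm of the residual
`(p, z, s)` has been removed: here `e = 2 - θ`, and `gZ • z = L v`. -/
noncomputable def slack (gM gZ gP e : ℝ) (a p z s v : Fin n → ℝ) : ℝ :=
  e * phiForm G gM gZ gP p z s
    + 2 * ((v + (3 / 2 : ℝ) • p) ⬝ᵥ G.lapMatrix ℝ *ᵥ (v + (3 / 2 : ℝ) • p))
    - 1 / 2 * (p ⬝ᵥ G.lapMatrix ℝ *ᵥ p) - 1 / 2 * (s ⬝ᵥ (a * s))

variable {e c : ℝ} {a : Fin n → ℝ}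

/-- The slack, without the parts of `Φ - κ` which are not needed on graphs with at least three
vertices. -/
theorem PhiBound.le_slack (h : PhiBound G κ gM gZ gP) (hn : 0 < n) (he0 : 0 < e)
    (heκ : e * κ = c / 2) (ha : ∀ i, a i ≤ c) (p z s v : Fin n → ℝ) :
    c / 2 * (z ⬝ᵥ z) + 1 / 2 * (c * (p ⬝ᵥ p) - p ⬝ᵥ G.lapMatrix ℝ *ᵥ p)
      + e * (gP - κ) * ((s + (gP - κ)⁻¹ • p) ⬝ᵥ (s + (gP - κ)⁻¹ • p))
      ≤ slack G gM gZ gP e a p z s v := by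
  have h1 := mul_nonneg he0.le (h.schur_nonneg hn p z)
  have h2 := dotProduct_lapMatrix_self_nonneg G (v + (3 / 2 : ℝ) • p)
  have h3 := dotProduct_mul_le ha s
  rw [slack, h.form_eq hn]
  have h4 : e * (κ * (p ⬝ᵥ p + z ⬝ᵥ z + s ⬝ᵥ s)) = c / 2 * (p ⬝ᵥ p + z ⬝ᵥ z + s ⬝ᵥ s) := by
    rw [← heκ]; ring
  linarith

/-- The slack is uniformly positive: the primal-dual operator is averaged, with a margin. -/
theorem exists_le_slack (hG : G.Connected) (hn : 2 ≤ n) (h : PhiBound G κ gM gZ gP)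
    (he0 : 0 < e) (heκ : e * κ = c / 2) (ha : ∀ i, a i ≤ c)
    (hc : maxLaplacianEigenvalue G ^ 2 ≤ c) :
    ∃ ε > 0, ∀ p z s v : Fin n → ℝ,
      ε * (p ⬝ᵥ p + z ⬝ᵥ z + s ⬝ᵥ s) ≤ slack G gM gZ gP e a p z s v := by
  have hσ := two_le_maxLaplacianEigenvalue hG hn
  set σ := maxLaplacianEigenvalue G with hσdef
  have hw : 0 < gP - κ := sub_pos.2 (h.kappa_lt (by omega))
  have hcσ : 0 < (c - σ) / 2 := by nlinarith
  have hc0 : 0 < c := by nlinarith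
  obtain ⟨ε, hε, hle⟩ := exists_le_of_shift (ι := Fin n) hcσ (mul_pos he0 hw) (gP - κ)
  refine ⟨min ε (c / 2), by positivity, fun p z s v => ?_⟩
  refine le_trans ?_ (h.le_slack (by omega) he0 heκ ha p z s v)
  have h1 := hle p s
  have h2 := dotProduct_lapMatrix_self_le G p
  have h3 := mul_le_mul_of_nonneg_right (min_le_left ε (c / 2))
    (add_nonneg (dotProduct_self_nonneg_real p) (dotProduct_self_nonneg_real s))
  have h4 := mul_le_mul_of_nonneg_right (min_le_right ε (c / 2)) (dotProduct_self_nonneg_real z)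
  rw [← hσdef] at h2
  linarith

theorem exists_le_slack_sub_coupling_of_three_le (hG : G.Connected) (hn : 3 ≤ n)
    (h : PhiBound G κ gM gZ gP) (he0 : 0 < e) (he1 : e < 2) (heκ : e * κ = c / 2)
    (ha : ∀ i, a i ≤ c) (hc : maxLaplacianEigenvalue G ^ 2 ≤ c) :
    ∃ ε > 0, ∀ p z s v : Fin n → ℝ, ε * (p ⬝ᵥ p + z ⬝ᵥ z + s ⬝ᵥ s)
      ≤ slack G gM gZ gP e a p z s v - 2 * (2 - e) * (p ⬝ᵥ G.adjMatrix ℝ *ᵥ z) := by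
  have hσ := two_le_maxLaplacianEigenvalue hG (by omega)
  set σ := maxLaplacianEigenvalue G with hσdef
  have hw : 0 < gP - κ := sub_pos.2 (h.kappa_lt (by omega))
  have hcσ : 0 < e / 2 * ((c - σ) / 2) := mul_pos (by linarith) (by nlinarith)
  have hc0 : 0 < c := by nlinarith
  obtain ⟨ε, hε, hle⟩ := exists_le_of_shift (ι := Fin n) hcσ (mul_pos he0 hw) (gP - κ)
  refine ⟨min ε (e / 2 * (c / 2)), by positivity, fun p z s v => ?_⟩
  refine le_trans ?_ (sub_le_sub_right (h.le_slack (by omega) he0 heκ ha p z s v) _)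
  have h1 := hle p s
  have h2 := dotProduct_lapMatrix_self_le G p
  have h3 := mul_le_mul_of_nonneg_right (min_le_left ε (e / 2 * (c / 2)))
    (add_nonneg (dotProduct_self_nonneg_real p) (dotProduct_self_nonneg_real s))
  have h4 := mul_le_mul_of_nonneg_right (min_le_right ε (e / 2 * (c / 2)))
    (dotProduct_self_nonneg_real z)
  rw [← hσdef] at h2
  set R := c / 2 * (z ⬝ᵥ z) + 1 / 2 * (c * (p ⬝ᵥ p) - p ⬝ᵥ G.lapMatrix ℝ *ᵥ p) with hR
  have hcross : 4 * (p ⬝ᵥ G.adjMatrix ℝ *ᵥ z) ≤ R := by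
    have h5 : p ⬝ᵥ G.adjMatrix ℝ *ᵥ z = z ⬝ᵥ G.adjMatrix ℝ *ᵥ p := by
      rw [dotProduct_mulVec, ← mulVec_transpose, (G.isSymm_adjMatrix (α := ℝ)).eq,
        dotProduct_comm]
    have h6 := two_mul_dotProduct_le (show 0 < c / 4 by positivity) z (G.adjMatrix ℝ *ᵥ p)
    have h7 := adjMatrix_mulVec_sq_le_slack hG hn hc p
    have h8 : (c / 4)⁻¹ * ((G.adjMatrix ℝ *ᵥ p) ⬝ᵥ (G.adjMatrix ℝ *ᵥ p))
        ≤ 1 / 4 * (c * (p ⬝ᵥ p) - p ⬝ᵥ G.lapMatrix ℝ *ᵥ p) := by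
      rw [inv_mul_le_iff₀ (by positivity)]
      linarith
    rw [h5]
    linarith
  have h9 := mul_le_mul_of_nonneg_left hcross (show 0 ≤ (2 - e) / 2 by linarith)
  have h10 : e / 2 * (c / 2 * (z ⬝ᵥ z) + (c - σ) / 2 * (p ⬝ᵥ p)) ≤ e / 2 * R :=
    mul_le_mul_of_nonneg_left (by rw [hR]; linarith) (by linarith)
  linarith

/-- The polynomial inequality behind the case of two microgrids. -/
theorem two_grid_polynomial {u x : ℝ} (hu0 : 0 < u) (hu1 : u < 1) (hx : 0 < x) :
    x * (3 * (x + 2) + 2 * u + u ^ 2) ^ 2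
      < (10 * x + 4 * u ^ 2) * ((x + 2) ^ 2 + u ^ 2 * (x + 2)) := by
  have hD : 0 < 4 - 8 * u - 16 * u ^ 2 + 44 * u ^ 3 - 13 * u ^ 4 := by
    nlinarith [sq_nonneg (u - 9 / 20), sq_nonneg (u * (u - 9 / 20)), mul_pos hu0 (sub_pos.2 hu1),
      mul_nonneg hu0.le (sq_nonneg (u - 9 / 20)),
      mul_nonneg (mul_pos hu0 (sub_pos.2 hu1)).le (sq_nonneg (u - 9 / 20))]
  have h1 := mul_pos hx (add_pos_of_nonneg_of_pos (sq_nonneg (x - (6 * u - 4 * u ^ 2))) hD)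
  have h2 : (10 * x + 4 * u ^ 2) * ((x + 2) ^ 2 + u ^ 2 * (x + 2))
      - x * (3 * (x + 2) + 2 * u + u ^ 2) ^ 2
      = 4 * (2 * u - x) ^ 2 + x * ((x - (6 * u - 4 * u ^ 2)) ^ 2
        + (4 - 8 * u - 16 * u ^ 2 + 44 * u ^ 3 - 13 * u ^ 4)) + 8 * u ^ 4 := by ring
  nlinarith [sq_nonneg (2 * u - x), sq_nonneg (u ^ 2)]

/-- The discriminant condition for two microgrids, in the scaled entries `k`, `X`, `Y` of `Φ`. -/
theorem two_grid_discrim {k X Y u : ℝ} (hu0 : 0 < u) (hu1 : u < 1) (hk : 2 ≤ k) (hX : 0 ≤ X)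
    (hY : 0 < Y) (hXY : 4 * u ^ 2 ≤ X * Y) :
    (3 * (k + Y) + 2 * u + u ^ 2) ^ 2 < (8 + k + X) * ((k + Y) ^ 2 + u ^ 2 * (k + Y)) := by
  set x := k + Y - 2 with hx
  have hx0 : 0 < x := by linarith
  have hG : k + Y = x + 2 := by linarith
  have h1 := two_grid_polynomial hu0 hu1 hx0
  have h2 : 10 * x + 4 * u ^ 2 ≤ x * (8 + k + X) := by
    nlinarith [mul_nonneg (sub_nonneg.2 hk) hX, mul_nonneg (sub_nonneg.2 hk) hY.le,
      mul_nonneg (sub_nonneg.2 hk) (sub_nonneg.2 hk)]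
  rw [hG]
  have h3 : 0 ≤ (x + 2) ^ 2 + u ^ 2 * (x + 2) := by positivity
  have h4 := mul_le_mul_of_nonneg_right h2 h3
  refine lt_of_mul_lt_mul_left ?_ hx0.le
  linarith

/-- With two microgrids, the coupling is only dominated thanks to the relation `gZ • z = L v`
and to the part of `Φ` above `κ`. -/
theorem exists_le_slack_sub_coupling_of_two {G : SimpleGraph (Fin 2)} [DecidableRel G.Adj]
    {a : Fin 2 → ℝ} (hG : G.Connected) (h : PhiBound G κ gM gZ gP) (he0 : 0 < e) (he1 : e < 1)
    (heκ : e * κ = c / 2) (ha : ∀ i, a i ≤ c) (hc : maxLaplacianEigenvalue G ^ 2 ≤ c) :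
    ∃ ε > 0, ∀ p z s v : Fin 2 → ℝ, gZ • z = G.lapMatrix ℝ *ᵥ v →
      ε * (p ⬝ᵥ p + z ⬝ᵥ z + s ⬝ᵥ s)
        ≤ slack G gM gZ gP e a p z s v - 2 * (2 - e) * (p ⬝ᵥ G.adjMatrix ℝ *ᵥ z) := by
  have hσ := two_le_maxLaplacianEigenvalue hG le_rfl
  have hc4 : 4 ≤ c := by nlinarith
  have hw : 0 < gP - κ := sub_pos.2 (h.kappa_lt (by omega))
  have hadj : G.Adj 0 1 := by
    obtain ⟨u, hu, v, hv, huv⟩ := exists_adj_of_connected hG (s := {0}) (a := 0) (b := 1)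
      (by simp) (by simp)
    rw [Set.mem_singleton_iff] at hu hv
    obtain rfl : v = 1 := by omega
    exact hu ▸ huv
  have hA : ∀ x : Fin 2 → ℝ, G.adjMatrix ℝ *ᵥ x = ![x 1, x 0] := by
    intro x
    ext i
    fin_cases i <;> simp [mulVec, dotProduct, SimpleGraph.adjMatrix_apply, hadj, hadj.symm]
  have hdeg : ∀ i, (G.degree i : ℝ) = 1 := by
    intro i
    rw [SimpleGraph.degree_eq_sum_if_adj, Fin.sum_univ_two]
    fin_cases i <;> simp [hadj, hadj.symm]
  have hL : ∀ x : Fin 2 → ℝ, G.lapMatrix ℝ *ᵥ x = ![x 0 - x 1, x 1 - x 0] := by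
    intro x
    rw [SimpleGraph.lapMatrix, sub_mulVec, hA]
    ext i
    rw [Pi.sub_apply, SimpleGraph.degMatrix_mulVec_apply, hdeg]
    fin_cases i <;> simp
  set x' := gM - κ - (gP - κ)⁻¹ with hx'
  set y' := gZ - κ with hy'
  have hschur : ∀ t r : ℝ, 0 ≤ x' * t ^ 2 + y' * r ^ 2 + 4 * (t * r) := by
    intro t r
    have h1 := h.schur_nonneg (by omega) ![t, -t] ![r, -r]
    rw [hL, ← hx', ← hy'] at h1
    simp [dotProduct, Fin.sum_univ_two] at h1
    linarith
  have hx'0 : 0 ≤ x' := by simpa using hschur 1 0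
  have hy'0 : 0 ≤ y' := by simpa using hschur 0 1
  have hy'pos : 0 < y' := by
    refine lt_of_le_of_ne hy'0 fun h0 => ?_
    have h1 := hschur 1 (-(x' + 1))
    rw [← h0] at h1
    linarith
  have hxy : 4 ≤ x' * y' := by
    have h1 := hschur y' (-2)
    have h2 : 0 ≤ y' * (x' * y' - 4) := by linarith
    linarith [nonneg_of_mul_nonneg_right h2 hy'pos]
  have hκ0 : 0 < κ := by
    by_contra! hle
    nlinarith [mul_nonneg he0.le (neg_nonneg.2 hle)]
  have hgZ : 0 < gZ := by linarith
  have hdisc := two_grid_discrim (k := e * κ) (X := e * x') (Y := e * y') he0 he1 (by linarith)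
    (by positivity) (by positivity) (by nlinarith [mul_le_mul_of_nonneg_left hxy (sq_nonneg e)])
  have hG' : e * κ + e * y' = e * gZ := by rw [hy']; ring
  rw [hG'] at hdisc
  have hdisc' : (6 * gZ + 4 + 2 * e) ^ 2 < 4 * (8 + e * κ + e * x') * (gZ ^ 2 + e * gZ) := by
    refine lt_of_mul_lt_mul_left ?_ (sq_nonneg e)
    linarith
  obtain ⟨ε₁, hε₁, hle₁⟩ := exists_le_of_discrim (show 0 < 8 + e * κ + e * x' by positivity)
    (show 0 < gZ ^ 2 + e * gZ by positivity) hdisc'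
  obtain ⟨ε₂, hε₂, hle₂⟩ := exists_le_of_shift (ι := Fin 2)
    (show 0 < min ε₁ (e * κ) / 2 by positivity) (mul_pos he0 hw) (gP - κ)
  refine ⟨min ε₂ (min ε₁ (e * κ) / 2), by positivity, fun p z s v hzv => ?_⟩
  rw [hL] at hzv
  have hz0 : gZ * z 0 = v 0 - v 1 := by simpa using congrFun hzv 0
  have hz1 : gZ * z 1 = v 1 - v 0 := by simpa using congrFun hzv 1
  have hz : z 1 = -z 0 := by
    have : gZ * (z 1 + z 0) = 0 := by linarith
    rcases mul_eq_zero.1 this with h1 | h1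
    · exact absurd h1 hgZ.ne'
    · linarith
  have hs := dotProduct_mul_le ha s
  -- `p` splits into its mean, which is not coupled, and the half difference, coupled to `z 0`
  have h1 := hle₁ ((p 0 - p 1) / 2) (z 0)
  have h2 := hle₂ p s
  set q := (s + (gP - κ)⁻¹ • p) ⬝ᵥ (s + (gP - κ)⁻¹ • p) with hq
  have hpp : p ⬝ᵥ p = 2 * ((p 0 + p 1) / 2) ^ 2 + 2 * ((p 0 - p 1) / 2) ^ 2 := by
    simp only [dotProduct, Fin.sum_univ_two]; ring
  have hzz : z ⬝ᵥ z = 2 * z 0 ^ 2 := by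
    simp only [dotProduct, Fin.sum_univ_two, hz]; ring
  have hslack : 2 * ((e * κ + e * x') * ((p 0 + p 1) / 2) ^ 2
      + ((8 + e * κ + e * x') * ((p 0 - p 1) / 2) ^ 2
        + (6 * gZ + 4 + 2 * e) * ((p 0 - p 1) / 2 * z 0) + (gZ ^ 2 + e * gZ) * z 0 ^ 2))
      + e * (gP - κ) * q
      ≤ slack G gM gZ gP e a p z s v - 2 * (2 - e) * (p ⬝ᵥ G.adjMatrix ℝ *ᵥ z) := by
    rw [slack, h.form_eq (by omega), ← hx', ← hy', ← hq, hpp, hzz, hA, hL, hL, hL]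
    have hv0 : v 0 = v 1 + gZ * z 0 := by linarith
    have hc' : c = 2 * (e * κ) := by linarith
    rw [hc'] at hs
    simp only [dotProduct, Fin.sum_univ_two, hz, hv0, Matrix.cons_val_zero, Matrix.cons_val_one,
      Pi.add_apply, Pi.smul_apply, smul_eq_mul] at hs ⊢
    rw [hy']
    linarith
  have hm1 : min ε₁ (e * κ) ≤ ε₁ := min_le_left _ _
  have hm2 : min ε₁ (e * κ) ≤ e * κ := min_le_right _ _
  have hm3 : min ε₂ (min ε₁ (e * κ) / 2) ≤ ε₂ := min_le_left _ _
  have hm4 : min ε₂ (min ε₁ (e * κ) / 2) ≤ min ε₁ (e * κ) / 2 := min_le_right _ _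
  have h3 := mul_le_mul_of_nonneg_right hm3
    (add_nonneg (dotProduct_self_nonneg_real p) (dotProduct_self_nonneg_real s))
  have h4 := mul_le_mul_of_nonneg_right hm4 (dotProduct_self_nonneg_real z)
  have h5 := mul_le_mul_of_nonneg_right hm1
    (add_nonneg (sq_nonneg ((p 0 - p 1) / 2)) (sq_nonneg (z 0)))
  have h6 := mul_le_mul_of_nonneg_right hm2 (sq_nonneg ((p 0 + p 1) / 2))
  have h7 : 0 ≤ e * x' * ((p 0 + p 1) / 2) ^ 2 := by positivity
  refine le_trans ?_ hslack
  have hmpos : 0 ≤ min ε₁ (e * κ) := by positivity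
  have h8 := mul_nonneg hmpos (sq_nonneg ((p 0 + p 1) / 2))
  have h9 := mul_nonneg hmpos (sq_nonneg ((p 0 - p 1) / 2))
  have h10 := mul_nonneg hmpos (sq_nonneg (z 0))
  rw [hzz] at h4 ⊢
  rw [hpp] at h2 h3 ⊢
  linarith

/-- Replacing `Φ` by its block diagonal part changes the form by the coupling
`2 p ⬝ A z`; the slack dominates this change. -/
theorem exists_le_slack_sub_coupling (hG : G.Connected) (hn : 2 ≤ n)
    (h : PhiBound G κ gM gZ gP) (he0 : 0 < e) (he1 : e < 1) (heκ : e * κ = c / 2)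
    (ha : ∀ i, a i ≤ c) (hc : maxLaplacianEigenvalue G ^ 2 ≤ c) :
    ∃ ε > 0, ∀ p z s v : Fin n → ℝ, gZ • z = G.lapMatrix ℝ *ᵥ v →
      ε * (p ⬝ᵥ p + z ⬝ᵥ z + s ⬝ᵥ s)
        ≤ slack G gM gZ gP e a p z s v - 2 * (2 - e) * (p ⬝ᵥ G.adjMatrix ℝ *ᵥ z) := by
  rcases Nat.lt_or_ge 2 n with h3 | h2
  · obtain ⟨ε, hε, hle⟩ := exists_le_slack_sub_coupling_of_three_le hG h3 h he0 (by linarith) heκ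
      ha hc
    exact ⟨ε, hε, fun p z s v _ => hle p z s v⟩
  · obtain rfl : n = 2 := by omega
    exact exists_le_slack_sub_coupling_of_two hG h he0 he1 heκ ha hc

end Slack

/-! ### The residual of the primal-dual operator -/

section Residual

open Matrix

variable {n : ℕ}

/-- The state whose microgrid `i` owns the block `x i = (μ i, z i, P i)`. -/
def toState (x : Fin n → ℝ × ℝ × ℝ) : State n :=
  ⟨fun i => (x i).1, fun i => (x i).2.1, fun i => (x i).2.2⟩

/-- The blocks of a state. -/
def State.blocks (w : State n) (i : Fin n) : ℝ × ℝ × ℝ := (w.mu i, w.z i, w.P i)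

/-- The residual `w - 𝒯 w` of the primal-dual operator, in block form. -/
noncomputable def pdResidual (pr : Problem n) (G : SimpleGraph (Fin n)) [DecidableRel G.Adj]
    (sMu sZ sG : ℝ) (x : Fin n → ℝ × ℝ × ℝ) : Fin n → ℝ × ℝ × ℝ := fun i =>
  ((toState x).mu i - muTilde pr G sMu (toState x) i,
    (toState x).z i - zTilde pr G sMu sZ (toState x) i,
    (toState x).P i - PTilde pr G sMu sG (toState x) i)

variable (G : SimpleGraph (Fin n)) [DecidableRel G.Adj]

/-- The inner product defined by `Φ` on block vectors. -/
noncomputable def phiBilin (gM gZ gP : ℝ) : LinearMap.BilinForm ℝ (Fin n → ℝ × ℝ × ℝ) :=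
  LinearMap.mk₂ ℝ (fun x y =>
    gM * ((toState x).mu ⬝ᵥ (toState y).mu) + gZ * ((toState x).z ⬝ᵥ (toState y).z)
      + gP * ((toState x).P ⬝ᵥ (toState y).P)
      + (toState x).mu ⬝ᵥ G.lapMatrix ℝ *ᵥ (toState y).z
      + (toState x).z ⬝ᵥ G.lapMatrix ℝ *ᵥ (toState y).mu
      + (toState x).mu ⬝ᵥ (toState y).P + (toState x).P ⬝ᵥ (toState y).mu)
    (fun x x' y => by
      have h1 : (toState (x + x')).mu = (toState x).mu + (toState x').mu := rfl
      have h2 : (toState (x + x')).z = (toState x).z + (toState x').z := rfl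
      have h3 : (toState (x + x')).P = (toState x).P + (toState x').P := rfl
      simp only [h1, h2, h3, add_dotProduct]
      ring)
    (fun r x y => by
      have h1 : (toState (r • x)).mu = r • (toState x).mu := rfl
      have h2 : (toState (r • x)).z = r • (toState x).z := rfl
      have h3 : (toState (r • x)).P = r • (toState x).P := rfl
      simp only [h1, h2, h3, smul_dotProduct, smul_eq_mul]
      ring)
    (fun x y y' => by
      have h1 : (toState (y + y')).mu = (toState y).mu + (toState y').mu := rfl
      have h2 : (toState (y + y')).z = (toState y).z + (toState y').z := rfl
      have h3 : (toState (y + y')).P = (toState y).P + (toState y').P := rfl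
      simp only [h1, h2, h3, dotProduct_add, mulVec_add]
      ring)
    (fun r x y => by
      have h1 : (toState (r • y)).mu = r • (toState y).mu := rfl
      have h2 : (toState (r • y)).z = r • (toState y).z := rfl
      have h3 : (toState (r • y)).P = r • (toState y).P := rfl
      simp only [h1, h2, h3, dotProduct_smul, mulVec_smul, smul_eq_mul]
      ring)

variable {G} {gM gZ gP : ℝ}

theorem phiBilin_apply (x y : Fin n → ℝ × ℝ × ℝ) : phiBilin G gM gZ gP x y =
    gM * ((toState x).mu ⬝ᵥ (toState y).mu) + gZ * ((toState x).z ⬝ᵥ (toState y).z)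
      + gP * ((toState x).P ⬝ᵥ (toState y).P)
      + (toState x).mu ⬝ᵥ G.lapMatrix ℝ *ᵥ (toState y).z
      + (toState x).z ⬝ᵥ G.lapMatrix ℝ *ᵥ (toState y).mu
      + (toState x).mu ⬝ᵥ (toState y).P + (toState x).P ⬝ᵥ (toState y).mu := rfl

theorem phiBilin_symm (x y : Fin n → ℝ × ℝ × ℝ) :
    phiBilin G gM gZ gP x y = phiBilin G gM gZ gP y x := by
  simp only [phiBilin_apply, dotProduct_comm (toState y).mu, dotProduct_comm (toState y).z,
    dotProduct_comm (toState y).P]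
  rw [dotProduct_lapMatrix_comm G (toState x).mu, dotProduct_lapMatrix_comm G (toState x).z,
    dotProduct_comm (toState y).z, dotProduct_comm (toState y).mu]
  ring

theorem phiBilin_self (x : Fin n → ℝ × ℝ × ℝ) : phiBilin G gM gZ gP x x
    = phiForm G gM gZ gP (toState x).mu (toState x).z (toState x).P := by
  rw [phiBilin_apply, phiForm, dotProduct_lapMatrix_comm G (toState x).z,
    dotProduct_comm (toState x).P (toState x).mu]
  ring

/-- The block diagonal part of `Φ` lacks the coupling through the adjacency matrix. -/
theorem sum_phiBilin_single (x : Fin n → ℝ × ℝ × ℝ) :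
    ∑ i, phiBilin G gM gZ gP (Pi.single i (x i)) (Pi.single i (x i))
      = phiForm G gM gZ gP (toState x).mu (toState x).z (toState x).P
        + 2 * ((toState x).mu ⬝ᵥ G.adjMatrix ℝ *ᵥ (toState x).z) := by
  have h1 : ∀ i, (toState (Pi.single i (x i))).mu = Pi.single i ((toState x).mu i) := fun i => by
    funext j
    by_cases h : j = i
    · subst h; simp [toState]
    · simp [toState, h]
  have h2 : ∀ i, (toState (Pi.single i (x i))).z = Pi.single i ((toState x).z i) := fun i => by
    funext j
    by_cases h : j = i
    · subst h; simp [toState]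
    · simp [toState, h]
  have h3 : ∀ i, (toState (Pi.single i (x i))).P = Pi.single i ((toState x).P i) := fun i => by
    funext j
    by_cases h : j = i
    · subst h; simp [toState]
    · simp [toState, h]
  have h4 : ∀ i, G.lapMatrix ℝ i i = G.degree i := fun i => by
    simp [SimpleGraph.lapMatrix, SimpleGraph.degMatrix]
  have h5 : G.lapMatrix ℝ *ᵥ (toState x).z
      = (fun i => (G.degree i : ℝ) * (toState x).z i) - G.adjMatrix ℝ *ᵥ (toState x).z := by
    rw [SimpleGraph.lapMatrix, sub_mulVec]
    congr 1
    funext i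
    rw [SimpleGraph.degMatrix_mulVec_apply]
  simp only [phiBilin_self, phiForm, h1, h2, h3, h5, dotProduct_sub]
  simp only [single_dotProduct, Pi.single_eq_same, mulVec_single, Pi.smul_apply, Matrix.col_apply,
    h4, MulOpposite.smul_eq_mul_unop, MulOpposite.unop_op]
  simp only [Finset.sum_add_distrib, ← Finset.mul_sum, dotProduct]
  ring

theorem norm_sq_le_sum (x : Fin n → ℝ × ℝ × ℝ) :
    ‖x‖ ^ 2 ≤ (toState x).mu ⬝ᵥ (toState x).mu + (toState x).z ⬝ᵥ (toState x).z
      + (toState x).P ⬝ᵥ (toState x).P := by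
  set R := (toState x).mu ⬝ᵥ (toState x).mu + (toState x).z ⬝ᵥ (toState x).z
      + (toState x).P ⬝ᵥ (toState x).P with hR
  have h0 : ∀ v : Fin n → ℝ, 0 ≤ v ⬝ᵥ v := dotProduct_self_nonneg_real
  have hle : ∀ (v : Fin n → ℝ) i, v i ^ 2 ≤ v ⬝ᵥ v := fun v i => by
    rw [sq]
    exact Finset.single_le_sum (f := fun j => v j * v j) (fun j _ => mul_self_nonneg _)
      (Finset.mem_univ i)
  have hR0 : 0 ≤ R := add_nonneg (add_nonneg (h0 _) (h0 _)) (h0 _)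
  have habs : ∀ t : ℝ, t ^ 2 ≤ R → ‖t‖ ≤ √R := fun t ht => by
    rw [Real.norm_eq_abs]; exact Real.abs_le_sqrt ht
  have hnorm : ‖x‖ ≤ √R := by
    refine (pi_norm_le_iff_of_nonneg (Real.sqrt_nonneg _)).2 fun i => ?_
    have hm := h0 (toState x).mu
    have hz := h0 (toState x).z
    have hP := h0 (toState x).P
    refine max_le (habs _ ?_) (max_le (habs _ ?_) (habs _ ?_))
    · have := hle (toState x).mu i; simp only [toState] at *; linarith
    · have := hle (toState x).z i; simp only [toState] at *; linarith
    · have := hle (toState x).P i; simp only [toState] at *; linarith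
  calc ‖x‖ ^ 2 ≤ √R ^ 2 := by gcongr
    _ = R := Real.sq_sqrt hR0

theorem phiBound_of_posSemidef {κ sMu sZ sG : ℝ}
    (h : (Phi G sMu sZ sG - κ • (1 : Matrix (Fin n ⊕ Fin n ⊕ Fin n)
      (Fin n ⊕ Fin n ⊕ Fin n) ℝ)).PosSemidef) : PhiBound G κ sMu⁻¹ sZ⁻¹ sG⁻¹ := by
  refine ⟨fun p z s => ?_⟩
  have h1 := h.dotProduct_mulVec_nonneg (Sum.elim p (Sum.elim z s))
  rw [star_trivial, sub_mulVec, dotProduct_sub, smul_mulVec, one_mulVec, dotProduct_smul, Phi,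
    fromBlocks_mulVec, Sum.elim_comp_inl, Sum.elim_comp_inr, fromCols_mulVec_sumElim,
    fromRows_mulVec, fromBlocks_mulVec, Sum.elim_comp_inl, Sum.elim_comp_inr,
    ← Sum.elim_add_add] at h1
  simp only [sumElim_dotProduct_sumElim, dotProduct_add, smul_mulVec, one_mulVec, zero_mulVec,
    dotProduct_smul, smul_eq_mul, dotProduct_comm s p, add_zero, zero_add,
    dotProduct_lapMatrix_comm G z p] at h1
  rw [phiForm]
  linarith

theorem proj_variational (pr : Problem n) {i : Fin n} (h : pr.lo i ≤ pr.hi i) (x : ℝ) {y : ℝ}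
    (hy1 : pr.lo i ≤ y) (hy2 : y ≤ pr.hi i) : (x - pr.proj i x) * (y - pr.proj i x) ≤ 0 := by
  unfold Problem.proj
  rcases le_total (pr.hi i) x with h1 | h1
  · rw [min_eq_left h1, max_eq_right h]
    exact mul_nonpos_of_nonneg_of_nonpos (by linarith) (by linarith)
  · rw [min_eq_right h1]
    rcases le_total (pr.lo i) x with h2 | h2
    · rw [max_eq_right h2]; simp
    · rw [max_eq_left h2]
      exact mul_nonpos_of_nonpos_of_nonneg (by linarith) (by linarith)

theorem lo_le_proj (pr : Problem n) (i : Fin n) (x : ℝ) : pr.lo i ≤ pr.proj i x := le_max_left _ _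

theorem proj_le_hi (pr : Problem n) {i : Fin n} (h : pr.lo i ≤ pr.hi i) (x : ℝ) :
    pr.proj i x ≤ pr.hi i := max_le h (min_le_left _ _)

variable {pr : Problem n} {sMu sZ sG : ℝ}

theorem residual_mu (hMu : sMu ≠ 0) (x : Fin n → ℝ × ℝ × ℝ) :
    sMu⁻¹ • (toState (pdResidual pr G sMu sZ sG x)).mu = G.lapMatrix ℝ *ᵥ (toState x).mu
      - G.lapMatrix ℝ *ᵥ (toState x).z - (toState x).P + pr.d := by
  funext i
  have h : (toState (pdResidual pr G sMu sZ sG x)).mu i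
      = (toState x).mu i - muTilde pr G sMu (toState x) i := rfl
  simp only [Pi.smul_apply, smul_eq_mul, h, muTilde, neighborDiff_eq_mulVec, Pi.add_apply,
    Pi.sub_apply]
  field_simp
  ring

theorem muTilde_eq (x : Fin n → ℝ × ℝ × ℝ) :
    muTilde pr G sMu (toState x)
      = (toState x).mu - (toState (pdResidual pr G sMu sZ sG x)).mu := by
  funext i
  have h : (toState (pdResidual pr G sMu sZ sG x)).mu i
      = (toState x).mu i - muTilde pr G sMu (toState x) i := rfl
  rw [Pi.sub_apply, h]
  ring

theorem residual_z (hZ : sZ ≠ 0) (x : Fin n → ℝ × ℝ × ℝ) :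
    sZ⁻¹ • (toState (pdResidual pr G sMu sZ sG x)).z = G.lapMatrix ℝ *ᵥ (toState x).mu
      - (2 : ℝ) • G.lapMatrix ℝ *ᵥ (toState (pdResidual pr G sMu sZ sG x)).mu := by
  funext i
  have h : (toState (pdResidual pr G sMu sZ sG x)).z i
      = (toState x).z i - zTilde pr G sMu sZ (toState x) i := rfl
  simp only [Pi.smul_apply, smul_eq_mul, h, zTilde, neighborDiff_eq_mulVec, Pi.sub_apply]
  rw [muTilde_eq (sZ := sZ) (sG := sG), mulVec_sub, Pi.sub_apply]
  field_simp
  ring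

theorem residual_P (x : Fin n → ℝ × ℝ × ℝ) (i : Fin n) :
    (toState x).P i - (toState (pdResidual pr G sMu sZ sG x)).P i
      = pr.proj i ((toState x).P i - sG * (pr.a i * (toState x).P i + pr.b i + (toState x).mu i
        - 2 * (toState (pdResidual pr G sMu sZ sG x)).mu i)) := by
  have h : (toState (pdResidual pr G sMu sZ sG x)).P i
      = (toState x).P i - PTilde pr G sMu sG (toState x) i := rfl
  rw [h, sub_sub_cancel, PTilde, muTilde_eq (sZ := sZ) (sG := sG), Problem.marginalCost,
    Pi.sub_apply]
  congr 2
  ring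

theorem toState_zero_mu : (toState (0 : Fin n → ℝ × ℝ × ℝ)).mu = 0 := rfl
theorem toState_zero_z : (toState (0 : Fin n → ℝ × ℝ × ℝ)).z = 0 := rfl
theorem toState_zero_P : (toState (0 : Fin n → ℝ × ℝ × ℝ)).P = 0 := rfl

theorem lapMatrix_mu_eq_zero (hZ : sZ ≠ 0) {y : Fin n → ℝ × ℝ × ℝ}
    (hy : pdResidual pr G sMu sZ sG y = 0) : G.lapMatrix ℝ *ᵥ (toState y).mu = 0 := by
  have h := residual_z (pr := pr) (G := G) (sMu := sMu) (sG := sG) hZ y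
  rw [hy, toState_zero_z, toState_zero_mu, mulVec_zero, smul_zero, smul_zero, sub_zero] at h
  exact h.symm

/-- The projection step: `P - 𝒯 P` solves a variational inequality, which is combined with the one
of the fixed point `y`. -/
theorem residual_P_inequality (hG : 0 < sG) (hlohi : ∀ i, pr.lo i ≤ pr.hi i)
    {x y : Fin n → ℝ × ℝ × ℝ} (hy : pdResidual pr G sMu sZ sG y = 0) {p s Δm ΔP : Fin n → ℝ}
    (hp : p = (toState (pdResidual pr G sMu sZ sG x)).mu)
    (hs : s = (toState (pdResidual pr G sMu sZ sG x)).P)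
    (hΔm : Δm = (toState x).mu - (toState y).mu) (hΔP : ΔP = (toState x).P - (toState y).P) :
    sG⁻¹ * (s ⬝ᵥ s) - 1 / 4 * (s ⬝ᵥ (pr.a * s)) + Δm ⬝ᵥ ΔP - Δm ⬝ᵥ s - 2 * (p ⬝ᵥ ΔP)
      + 2 * (p ⬝ᵥ s) ≤ sG⁻¹ * (s ⬝ᵥ ΔP) := by
  simp only [dotProduct, Finset.mul_sum, ← Finset.sum_add_distrib, ← Finset.sum_sub_distrib,
    Pi.mul_apply]
  refine Finset.sum_le_sum fun i _ => ?_
  have h1 := residual_P (pr := pr) (G := G) (sMu := sMu) (sZ := sZ) (sG := sG) x i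
  have h2 := residual_P (pr := pr) (G := G) (sMu := sMu) (sZ := sZ) (sG := sG) y i
  rw [hy, toState_zero_P, toState_zero_mu, Pi.zero_apply, sub_zero, mul_zero, sub_zero] at h2
  rw [← hp, ← hs] at h1
  have hPy1 : pr.lo i ≤ (toState y).P i := by rw [h2]; exact lo_le_proj pr i _
  have hPy2 : (toState y).P i ≤ pr.hi i := by rw [h2]; exact proj_le_hi pr (hlohi i) _
  have hPx1 : pr.lo i ≤ (toState x).P i - s i := by rw [h1]; exact lo_le_proj pr i _
  have hPx2 : (toState x).P i - s i ≤ pr.hi i := by rw [h1]; exact proj_le_hi pr (hlohi i) _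
  have h3 := proj_variational pr (hlohi i) ((toState x).P i - sG * (pr.a i * (toState x).P i
    + pr.b i + (toState x).mu i - 2 * p i)) hPy1 hPy2
  have h4 := proj_variational pr (hlohi i) ((toState y).P i - sG * (pr.a i * (toState y).P i
    + pr.b i + (toState y).mu i)) hPx1 hPx2
  rw [← h1] at h3
  rw [← h2] at h4
  have hm : Δm i = (toState x).mu i - (toState y).mu i := by rw [hΔm]; rfl
  have hP : ΔP i = (toState x).P i - (toState y).P i := by rw [hΔP]; rfl
  have h5 : 0 ≤ (s i - sG * (pr.a i * ΔP i + Δm i - 2 * p i)) * (ΔP i - s i) := by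
    rw [hm, hP]
    nlinarith
  have h6 := mul_nonneg (inv_nonneg.2 hG.le) h5
  have h7 : sG⁻¹ * ((s i - sG * (pr.a i * ΔP i + Δm i - 2 * p i)) * (ΔP i - s i))
      = (sG⁻¹ * s i - (pr.a i * ΔP i + Δm i - 2 * p i)) * (ΔP i - s i) := by
    field_simp
  -- the minimum over `ΔP i` of `a * ΔP ^ 2 - a * ΔP * s` is `- a * s ^ 2 / 4`
  have h8 := mul_nonneg (pr.a_pos i).le (sq_nonneg (ΔP i - s i / 2))
  rw [h7] at h6
  nlinarith

/-- **Lower bound for the decrease of the square `Φ`-distance to a fixed point `y`.** The `z`-row of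
the operator expresses the multiplier error of `x` through the residual, hence the exact form of the
slack. -/
theorem le_phiBilin_residual (hMu : sMu ≠ 0) (hZ : sZ ≠ 0) (hG : 0 < sG)
    (hlohi : ∀ i, pr.lo i ≤ pr.hi i) (e : ℝ) {x y : Fin n → ℝ × ℝ × ℝ}
    (hy : pdResidual pr G sMu sZ sG y = 0) :
    let r := toState (pdResidual pr G sMu sZ sG x)
    let v := (toState x).mu - (toState y).mu - (2 : ℝ) • r.mu
    sZ⁻¹ • r.z = G.lapMatrix ℝ *ᵥ v ∧
    (2 - e) * phiForm G sMu⁻¹ sZ⁻¹ sG⁻¹ r.mu r.z r.P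
      + slack G sMu⁻¹ sZ⁻¹ sG⁻¹ e pr.a r.mu r.z r.P v
      ≤ 2 * phiBilin G sMu⁻¹ sZ⁻¹ sG⁻¹ (pdResidual pr G sMu sZ sG x) (x - y) := by
  intro r v
  have hLy := lapMatrix_mu_eq_zero hZ hy
  set p := r.mu with hp
  set z := r.z with hz
  set s := r.P with hs
  set Δm := (toState x).mu - (toState y).mu with hΔm
  set Δz := (toState x).z - (toState y).z with hΔz
  set ΔP := (toState x).P - (toState y).P with hΔP
  have hmu : sMu⁻¹ • p = G.lapMatrix ℝ *ᵥ Δm - G.lapMatrix ℝ *ᵥ Δz - ΔP := by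
    have h1 := residual_mu (pr := pr) (G := G) (sZ := sZ) (sG := sG) hMu x
    have h2 := residual_mu (pr := pr) (G := G) (sZ := sZ) (sG := sG) hMu y
    rw [hy, toState_zero_mu, smul_zero] at h2
    rw [hp, h1, hΔm, hΔz, hΔP, mulVec_sub, mulVec_sub, ← sub_zero (_ + pr.d), h2]
    abel
  have hzv : sZ⁻¹ • z = G.lapMatrix ℝ *ᵥ Δm - (2 : ℝ) • G.lapMatrix ℝ *ᵥ p := by
    have h1 := residual_z (pr := pr) (G := G) (sMu := sMu) (sG := sG) hZ x
    rw [hz, h1, hΔm, mulVec_sub, hLy, sub_zero]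
  have hv0 : v = Δm - (2 : ℝ) • p := rfl
  refine ⟨by rw [hv0, mulVec_sub _ Δm, mulVec_smul, hzv], ?_⟩
  have hPin := residual_P_inequality hG hlohi hy hp hs hΔm hΔP
  have e1 : sMu⁻¹ * (p ⬝ᵥ Δm)
      = Δm ⬝ᵥ G.lapMatrix ℝ *ᵥ Δm - Δm ⬝ᵥ G.lapMatrix ℝ *ᵥ Δz - Δm ⬝ᵥ ΔP := by
    rw [← smul_eq_mul, ← smul_dotProduct, hmu, dotProduct_comm, dotProduct_sub, dotProduct_sub]
  have e2 : sMu⁻¹ * (p ⬝ᵥ p)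
      = p ⬝ᵥ G.lapMatrix ℝ *ᵥ Δm - p ⬝ᵥ G.lapMatrix ℝ *ᵥ Δz - p ⬝ᵥ ΔP := by
    rw [← smul_eq_mul, ← dotProduct_smul, hmu, dotProduct_sub, dotProduct_sub]
  have e3 : sZ⁻¹ * (z ⬝ᵥ Δz)
      = Δz ⬝ᵥ G.lapMatrix ℝ *ᵥ Δm - 2 * (Δz ⬝ᵥ G.lapMatrix ℝ *ᵥ p) := by
    rw [← smul_eq_mul, ← smul_dotProduct, hzv, dotProduct_comm, dotProduct_sub, dotProduct_smul,
      smul_eq_mul]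
  have e4 : sZ⁻¹ * (z ⬝ᵥ z)
      = z ⬝ᵥ G.lapMatrix ℝ *ᵥ Δm - 2 * (z ⬝ᵥ G.lapMatrix ℝ *ᵥ p) := by
    rw [← smul_eq_mul, ← dotProduct_smul, hzv, dotProduct_sub, dotProduct_smul, smul_eq_mul]
  have hB : phiBilin G sMu⁻¹ sZ⁻¹ sG⁻¹ (pdResidual pr G sMu sZ sG x) (x - y)
      = sMu⁻¹ * (p ⬝ᵥ Δm) + sZ⁻¹ * (z ⬝ᵥ Δz) + sG⁻¹ * (s ⬝ᵥ ΔP)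
        + p ⬝ᵥ G.lapMatrix ℝ *ᵥ Δz + z ⬝ᵥ G.lapMatrix ℝ *ᵥ Δm + p ⬝ᵥ ΔP + s ⬝ᵥ Δm := rfl
  have hv : v + (3 / 2 : ℝ) • p = Δm - (1 / 2 : ℝ) • p := by
    rw [hv0]
    module
  rw [hB, slack, hv]
  simp only [phiForm, mulVec_sub, mulVec_smul, sub_dotProduct, dotProduct_sub, smul_dotProduct,
    dotProduct_smul, smul_eq_mul]
  rw [dotProduct_lapMatrix_comm G Δz Δm] at e3
  rw [dotProduct_lapMatrix_comm G Δz p] at e3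
  rw [dotProduct_lapMatrix_comm G z p] at e4
  rw [dotProduct_lapMatrix_comm G Δm p, dotProduct_comm s Δm]
  linarith

end Residual

/-! ### Fixed points and optimality -/

section Optimality

open Matrix

variable {n : ℕ} {pr : Problem n}

theorem cost_tangent_le (pr : Problem n) (i : Fin n) (x y : ℝ) :
    pr.cost i x + pr.marginalCost i x * (y - x) ≤ pr.cost i y := by
  have h := mul_nonneg (pr.a_pos i).le (sq_nonneg (y - x))
  simp only [Problem.cost, Problem.marginalCost]
  linarith

theorem lo_le_hi_of_feasible (h : pr.feasibleSet.Nonempty) (i : Fin n) : pr.lo i ≤ pr.hi i := by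
  obtain ⟨P, -, hP⟩ := h
  exact (hP i).1.trans (hP i).2

/-- Sufficiency of the optimality conditions: power balance, and minimality of every `P i` for the
cost with price `m` over its generation limits. -/
theorem isPrimalDualOptimal_of_variational {P : Fin n → ℝ} {m : ℝ} (hP : P ∈ pr.feasibleSet)
    (hvar : ∀ i y, pr.lo i ≤ y → y ≤ pr.hi i → 0 ≤ (pr.marginalCost i (P i) + m) * (y - P i)) :
    pr.IsPrimalDualOptimal P m := by
  refine ⟨⟨hP, fun Q hQ => ?_⟩, ?_⟩
  · have hsum : ∑ i, (Q i - P i) = 0 := by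
      rw [Finset.sum_sub_distrib, hQ.1, hP.1, sub_self]
    have h1 : ∑ i, (pr.cost i (P i) - m * (Q i - P i)) ≤ ∑ i, pr.cost i (Q i) := by
      refine Finset.sum_le_sum fun i _ => ?_
      have h2 := hvar i (Q i) (hQ.2 i).1 (hQ.2 i).2
      have h3 := cost_tangent_le pr i (P i) (Q i)
      linarith
    rw [Finset.sum_sub_distrib, ← Finset.mul_sum, hsum, mul_zero, sub_zero] at h1
    exact h1
  · set g : Fin n → ℝ := fun i => pr.marginalCost i (P i) + m with hg
    refine ⟨fun i => max (g i) 0, fun i => max (-g i) 0, fun i => le_max_right _ _,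
      fun i => le_max_right _ _, fun m' gm' gp' hgm hgp => ?_⟩
    have hlow : (pr.totalCost P : EReal)
        ≤ pr.dualFunction m (fun i => max (g i) 0) (fun i => max (-g i) 0) := by
      refine le_iInf fun Q => EReal.coe_le_coe_iff.2 ?_
      have h1 : ∑ i, (pr.cost i (P i) + m * (P i - pr.d i)) ≤ ∑ i, (pr.cost i (Q i)
          + m * (Q i - pr.d i) + max (g i) 0 * (pr.lo i - Q i)
          + max (-g i) 0 * (Q i - pr.hi i)) := by
        refine Finset.sum_le_sum fun i _ => ?_
        have h2 := cost_tangent_le pr i (P i) (Q i)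
        obtain ⟨hlo, hhi⟩ := hP.2 i
        have hgi : pr.marginalCost i (P i) = g i - m := by simp only [hg]; ring
        rw [hgi] at h2
        rcases lt_trichotomy (g i) 0 with h | h | h
        · have h3 := hvar i (pr.hi i) (hlo.trans hhi) le_rfl
          have h4 : P i = pr.hi i := le_antisymm hhi (by
            have := nonpos_of_mul_nonneg_right h3 h
            linarith)
          rw [max_eq_right h.le, max_eq_left (by linarith), ← h4]
          linarith
        · rw [h, neg_zero, max_self]
          rw [h] at h2
          linarith
        · have h3 := hvar i (pr.lo i) le_rfl (hlo.trans hhi)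
          have h4 : P i = pr.lo i := le_antisymm (by
            have := nonneg_of_mul_nonneg_right h3 h
            linarith) hlo
          rw [max_eq_left h.le, max_eq_right (by linarith), ← h4]
          linarith
      simp only [Finset.sum_add_distrib, ← Finset.mul_sum, Finset.sum_sub_distrib] at h1
      rw [hP.1, sub_self, mul_zero, add_zero] at h1
      exact h1
    refine le_trans (iInf_le _ P) (le_trans (EReal.coe_le_coe_iff.2 ?_) hlow)
    have h1 : ∑ i, gm' i * (pr.lo i - P i) ≤ 0 := Finset.sum_nonpos fun i _ =>
      mul_nonpos_of_nonneg_of_nonpos (hgm i) (by linarith [(hP.2 i).1])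
    have h2 : ∑ i, gp' i * (P i - pr.hi i) ≤ 0 := Finset.sum_nonpos fun i _ =>
      mul_nonpos_of_nonneg_of_nonpos (hgp i) (by linarith [(hP.2 i).2])
    rw [Problem.lagrangian, hP.1, sub_self, mul_zero]
    linarith

variable {G : SimpleGraph (Fin n)} [DecidableRel G.Adj] {sMu sZ sG : ℝ}

theorem sum_lapMatrix_mulVec (z : Fin n → ℝ) : ∑ i, (G.lapMatrix ℝ *ᵥ z) i = 0 := by
  have h : (fun _ : Fin n => (1 : ℝ)) ⬝ᵥ G.lapMatrix ℝ *ᵥ z = 0 := by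
    rw [dotProduct_lapMatrix_comm, SimpleGraph.lapMatrix_mulVec_const_eq_zero, dotProduct_zero]
  simpa [dotProduct] using h

/-- A fixed point of the primal-dual operator is a consensus state at a primal-dual solution. -/
theorem exists_isPrimalDualOptimal_of_residual_eq_zero (hconn : G.Connected) (hMu : sMu ≠ 0)
    (hZ : sZ ≠ 0) (hG : 0 < sG) (hlohi : ∀ i, pr.lo i ≤ pr.hi i) {y : Fin n → ℝ × ℝ × ℝ}
    (hy : pdResidual pr G sMu sZ sG y = 0) :
    ∃ m, (∀ i, (toState y).mu i = m) ∧ pr.IsPrimalDualOptimal (toState y).P m := by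
  have hL := lapMatrix_mu_eq_zero hZ hy
  have hconst := (G.lapMatrix_mulVec_eq_zero_iff_forall_reachable).1 hL
  obtain ⟨i₀⟩ := hconn.nonempty
  have hm : ∀ i, (toState y).mu i = (toState y).mu i₀ := fun i =>
    hconst i i₀ (hconn.preconnected i i₀)
  refine ⟨(toState y).mu i₀, hm, ?_⟩
  have hproj : ∀ i, (toState y).P i = pr.proj i ((toState y).P i
      - sG * (pr.marginalCost i ((toState y).P i) + (toState y).mu i₀)) := by
    intro i
    have h := residual_P (pr := pr) (G := G) (sMu := sMu) (sZ := sZ) (sG := sG) y i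
    rw [hy, toState_zero_P, toState_zero_mu, Pi.zero_apply, sub_zero, mul_zero, sub_zero, hm i]
      at h
    exact h
  refine isPrimalDualOptimal_of_variational ⟨?_, fun i => ?_⟩ fun i x hx1 hx2 => ?_
  · have h := residual_mu (pr := pr) (G := G) (sZ := sZ) (sG := sG) hMu y
    rw [hy, toState_zero_mu, smul_zero, hL] at h
    have h1 : ∑ i, ((toState y).P i - pr.d i) = ∑ i, -(G.lapMatrix ℝ *ᵥ (toState y).z) i := by
      refine Finset.sum_congr rfl fun i _ => ?_
      have := congrFun h i
      simp only [Pi.add_apply, Pi.sub_apply, Pi.zero_apply] at this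
      linarith
    rw [Finset.sum_sub_distrib, Finset.sum_neg_distrib, sum_lapMatrix_mulVec] at h1
    linarith
  · rw [hproj i]
    exact ⟨lo_le_proj pr i _, proj_le_hi pr (hlohi i) _⟩
  · have h := proj_variational pr (hlohi i) ((toState y).P i
      - sG * (pr.marginalCost i ((toState y).P i) + (toState y).mu i₀)) hx1 hx2
    rw [← hproj i] at h
    refine nonneg_of_mul_nonneg_right (a := sG) ?_ hG
    linarith

/-- A price at which the individually optimal dispatches meet the demand; by the intermediate
value theorem. -/
theorem exists_price (hfeas : pr.feasibleSet.Nonempty) :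
    ∃ m : ℝ, ∑ i, pr.proj i ((-m - pr.b i) / pr.a i) = ∑ i, pr.d i := by
  have hlohi := lo_le_hi_of_feasible hfeas
  obtain ⟨P, hPsum, hP⟩ := hfeas
  have hcont : Continuous fun m : ℝ => ∑ i, pr.proj i ((-m - pr.b i) / pr.a i) := by
    unfold Problem.proj
    fun_prop
  have habs : ∀ (f : Fin n → ℝ) i, f i ≤ ∑ j, |f j| := fun f i => (le_abs_self _).trans
    (Finset.single_le_sum (f := fun j => |f j|) (fun j _ => abs_nonneg _) (Finset.mem_univ i))
  refine mem_range_of_exists_le_of_exists_ge hcont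
    ⟨∑ i, |-pr.b i - pr.a i * pr.lo i|, ?_⟩ ⟨-∑ i, |pr.a i * pr.hi i + pr.b i|, ?_⟩
  · rw [← hPsum]
    refine Finset.sum_le_sum fun i _ => le_trans (le_of_eq ?_) (hP i).1
    have h1 := habs (fun i => -pr.b i - pr.a i * pr.lo i) i
    refine max_eq_left ((min_le_right _ _).trans ?_)
    rw [div_le_iff₀ (pr.a_pos i)]
    linarith
  · rw [← hPsum]
    refine Finset.sum_le_sum fun i _ => le_trans (hP i).2 (le_of_eq ?_)
    have h1 := habs (fun i => pr.a i * pr.hi i + pr.b i) i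
    have h2 : pr.hi i ≤ (- -∑ i, |pr.a i * pr.hi i + pr.b i| - pr.b i) / pr.a i := by
      rw [le_div_iff₀ (pr.a_pos i)]
      linarith
    rw [Problem.proj, min_eq_left h2, max_eq_right (hlohi i)]

/-- The optimal dispatch of a microgrid at price `m` is stationary under the projected gradient
step. -/
theorem proj_step_eq (hsG : 0 < sG) {i : Fin n} (h : pr.lo i ≤ pr.hi i) (m : ℝ) :
    pr.proj i (pr.proj i ((-m - pr.b i) / pr.a i)
      - sG * (pr.a i * pr.proj i ((-m - pr.b i) / pr.a i) + pr.b i + m))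
      = pr.proj i ((-m - pr.b i) / pr.a i) := by
  set t := (-m - pr.b i) / pr.a i with ht
  have ha := pr.a_pos i
  have hbm : pr.b i + m = -(pr.a i * t) := by
    rw [ht, mul_div_cancel₀ _ ha.ne']
    ring
  have hgrad : ∀ P, sG * (pr.a i * P + pr.b i + m) = sG * pr.a i * (P - t) := fun P => by
    rw [add_assoc, hbm]; ring
  have hk : 0 < sG * pr.a i := mul_pos hsG ha
  rw [hgrad]
  rcases le_total t (pr.lo i) with h1 | h1
  · have hP : pr.proj i t = pr.lo i := max_eq_left ((min_le_right _ _).trans h1)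
    rw [hP]
    refine max_eq_left ((min_le_right _ _).trans ?_)
    have := mul_nonneg hk.le (sub_nonneg.2 h1)
    linarith
  · rcases le_total (pr.hi i) t with h2 | h2
    · have hP : pr.proj i t = pr.hi i := by
        rw [Problem.proj, min_eq_left h2, max_eq_right h]
      rw [hP, Problem.proj, min_eq_left, max_eq_right h]
      have := mul_nonneg hk.le (sub_nonneg.2 h2)
      linarith
    · have hP : pr.proj i t = t := by
        rw [Problem.proj, min_eq_right h2, max_eq_right h1]
      rw [hP, sub_self, mul_zero, sub_zero, hP]

theorem exists_residual_eq_zero (hconn : G.Connected) (hMu : sMu ≠ 0) (hZ : sZ ≠ 0) (hG : 0 < sG)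
    (hfeas : pr.feasibleSet.Nonempty) : ∃ y, pdResidual pr G sMu sZ sG y = 0 := by
  have hlohi := lo_le_hi_of_feasible hfeas
  obtain ⟨m, hm⟩ := exists_price hfeas
  set P : Fin n → ℝ := fun i => pr.proj i ((-m - pr.b i) / pr.a i) with hP
  obtain ⟨z, hz⟩ := exists_lapMatrix_mulVec_eq hconn (b := pr.d - P) (by
    simp only [Pi.sub_apply, Finset.sum_sub_distrib, hm, sub_self])
  set y : Fin n → ℝ × ℝ × ℝ := fun i => (m, z i, P i) with hy
  have hLm : G.lapMatrix ℝ *ᵥ (toState y).mu = 0 :=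
    (G.lapMatrix_mulVec_eq_zero_iff_forall_adj).2 fun _ _ _ => rfl
  have h1 : (toState (pdResidual pr G sMu sZ sG y)).mu = 0 := by
    have h := residual_mu (pr := pr) (G := G) (sZ := sZ) (sG := sG) hMu y
    have hzz : G.lapMatrix ℝ *ᵥ (toState y).z = pr.d - (toState y).P := hz
    rw [hLm, hzz, zero_sub, neg_sub, sub_sub_cancel_left, neg_add_cancel] at h
    exact (smul_eq_zero.1 h).resolve_left (inv_ne_zero hMu)
  have h2 : (toState (pdResidual pr G sMu sZ sG y)).z = 0 := by
    have h := residual_z (pr := pr) (G := G) (sMu := sMu) (sG := sG) hZ y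
    rw [h1, hLm, mulVec_zero, smul_zero, sub_zero] at h
    exact (smul_eq_zero.1 h).resolve_left (inv_ne_zero hZ)
  have h3 : ∀ i, (toState (pdResidual pr G sMu sZ sG y)).P i = 0 := by
    intro i
    have h := residual_P (pr := pr) (G := G) (sMu := sMu) (sZ := sZ) (sG := sG) y i
    have h4 := proj_step_eq (pr := pr) hG (hlohi i) m
    rw [h1, Pi.zero_apply, mul_zero, sub_zero] at h
    have h5 : (toState y).P i = pr.proj i ((-m - pr.b i) / pr.a i) := rfl
    have h6 : (toState y).mu i = m := rfl
    rw [h5, h6, h4] at h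
    linarith
  exact ⟨y, funext fun i => Prod.ext (congrFun h1 i) (Prod.ext (congrFun h2 i) (h3 i))⟩

theorem continuous_residual : Continuous (pdResidual pr G sMu sZ sG) := by
  unfold pdResidual PTilde zTilde muTilde neighborDiff Problem.proj Problem.marginalCost toState
  fun_prop

end Optimality

/-! ### Convergence of the algorithm -/

section Convergence

variable {n : ℕ} {pr : Problem n} {G : SimpleGraph (Fin n)} [DecidableRel G.Adj] {sMu sZ sG : ℝ}

theorem zeta_pos (hn : 0 < n) {σ : ℝ} (hσ : 0 < σ) : 0 < pr.zeta σ := by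
  have : Nonempty (Fin n) := ⟨⟨0, hn⟩⟩
  have hinf : 0 < ⨅ i, pr.a i := by
    obtain ⟨i, hi⟩ := exists_eq_ciInf_of_finite (f := pr.a)
    rw [← hi]
    exact pr.a_pos i
  have hsup : 0 < ⨆ i, pr.a i :=
    (pr.a_pos ⟨0, hn⟩).trans_le (le_ciSup (Set.finite_range pr.a).bddAbove _)
  exact lt_min (by positivity) (by positivity)

theorem sq_le_inv_zeta (hn : 0 < n) {σ : ℝ} (hσ : 0 < σ) : σ ^ 2 ≤ (pr.zeta σ)⁻¹ := by
  rw [le_inv_comm₀ (by positivity) (zeta_pos hn hσ), ← one_div]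
  exact min_le_left _ _

theorem a_le_inv_zeta (hn : 0 < n) {σ : ℝ} (hσ : 0 < σ) (i : Fin n) :
    pr.a i ≤ (pr.zeta σ)⁻¹ := by
  have hinf : ⨅ j, pr.a j ≤ pr.a i := ciInf_le (Set.finite_range pr.a).bddBelow i
  have hsup : pr.a i ≤ ⨆ j, pr.a j := le_ciSup (Set.finite_range pr.a).bddAbove i
  have ha := pr.a_pos i
  rw [le_inv_comm₀ ha (zeta_pos hn hσ)]
  refine (min_le_right _ _).trans ?_
  have hsup0 : 0 < ⨆ j, pr.a j := ha.trans_le hsup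
  rw [div_le_iff₀ (pow_pos hsup0 2), inv_mul_eq_div, le_div_iff₀ ha]
  nlinarith

/-- A run of the algorithm moves the activated block along the residual at the delayed state. -/
theorem IsRun.blocks_succ {η : ℕ → ℝ} {w0 : State n} {act : ℕ → Fin n} {τ : ℕ → Fin n → ℕ}
    {w : ℕ → State n} (h : IsRun pr G sMu sZ sG η w0 act τ w) (k : ℕ) :
    (w (k + 1)).blocks = (w k).blocks - η k • (Pi.single (act k)
      (pdResidual pr G sMu sZ sG (fun j => (w (k - τ k j)).blocks j) (act k)) :
        Fin n → ℝ × ℝ × ℝ) := by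
  funext j
  by_cases hj : j = act k
  · subst hj
    have hdel : toState (fun j => (w (k - τ k j)).blocks j) = delayedState w k (τ k) := rfl
    rw [Pi.sub_apply, Pi.smul_apply, Pi.single_eq_same, pdResidual, hdel]
    refine Prod.ext ?_ (Prod.ext ?_ ?_)
    · refine (h.mu_step k).trans ?_
      simp only [State.blocks, Prod.fst_sub, Prod.smul_fst, smul_eq_mul]
      ring
    · refine (h.z_step k).trans ?_
      simp only [State.blocks, Prod.snd_sub, Prod.fst_sub, Prod.smul_snd, Prod.smul_fst,
        smul_eq_mul]
      ring
    · refine (h.P_step k).trans ?_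
      simp only [State.blocks, Prod.snd_sub, Prod.smul_snd, smul_eq_mul]
      ring
  · obtain ⟨h1, h2, h3⟩ := h.idle k j hj
    rw [Pi.sub_apply, Pi.smul_apply, Pi.single_eq_of_ne hj, smul_zero, sub_zero]
    exact Prod.ext h1 (Prod.ext h2 h3)

end Convergence

end Dispatch

theorem theorem2 {n : ℕ} (hn : 2 ≤ n)
    (pr : Dispatch.Problem n) (hSlater : pr.feasibleSet.Nonempty)
    (G : SimpleGraph (Fin n)) [DecidableRel G.Adj] (hG : G.Connected)
    (sMu sZ sG : ℝ) (hsMu : 0 < sMu) (hsZ : 0 < sZ) (hsG : 0 < sG)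
    (ζ κ : ℝ) (hζ : ζ = pr.zeta (Dispatch.maxLaplacianEigenvalue G)) (hκ : 1 / (2 * ζ) < κ)
    (hPhi : (Dispatch.Phi G sMu sZ sG - κ • (1 : Matrix (Fin n ⊕ Fin n ⊕ Fin n)
      (Fin n ⊕ Fin n ⊕ Fin n) ℝ)).PosSemidef)
    (χ : ℕ) (η : ℕ → ℝ) (ηmin : ℝ) (hηmin : 0 < ηmin) (hη_lower : ∀ k, ηmin ≤ η k)
    (hη_upper : ∀ k, η k < 1 / (1 + 2 * (χ : ℝ) / √(n : ℝ)) * ((4 * κ * ζ - 1) / (2 * κ * ζ)))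
    {Ω : Type*} {mΩ : MeasurableSpace Ω} (Pr : MeasureTheory.Measure Ω)
    [MeasureTheory.IsProbabilityMeasure Pr]
    (ℱ : MeasureTheory.Filtration ℕ mΩ) (act : ℕ → Ω → Fin n) (τ : ℕ → Fin n → Ω → ℕ)
    (hact : Dispatch.IsUniformActivation Pr ℱ act τ)
    (hτ : ∀ k j ω, τ k j ω ≤ χ)
    (w0 : Dispatch.State n) (hw0 : ∀ i, pr.lo i ≤ w0.P i ∧ w0.P i ≤ pr.hi i)
    (w : ℕ → Ω → Dispatch.State n)
    (hw : ∀ ω, Dispatch.IsRun pr G sMu sZ sG η w0 (fun k => act k ω) (fun k j => τ k j ω)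
      (fun k => w k ω)) :
    ∀ᵐ ω ∂Pr, ∃ (Pstar : Fin n → ℝ) (mstar : ℝ), pr.IsPrimalDualOptimal Pstar mstar ∧
      (∀ i, Filter.Tendsto (fun k => (w k ω).P i) Filter.atTop (nhds (Pstar i))) ∧
      (∀ i, Filter.Tendsto (fun k => (w k ω).mu i) Filter.atTop (nhds mstar)) := by
  open Dispatch in
  have hn0 : 0 < n := by omega
  have hσ : 0 < maxLaplacianEigenvalue G := by linarith [two_le_maxLaplacianEigenvalue hG hn]
  have hζ0 : 0 < ζ := hζ ▸ zeta_pos hn0 hσ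
  have hκ0 : 0 < κ := lt_trans (by positivity) hκ
  have hlohi := lo_le_hi_of_feasible hSlater
  have hΦ := phiBound_of_posSemidef hPhi
  -- the relaxation bound is `(2 - e) / (1 + 2 χ / √n)`, where `e < 1` as `κ > 1 / (2 ζ)`
  set e : ℝ := 1 / (2 * κ * ζ) with he
  have he0 : 0 < e := by positivity
  have he1 : e < 1 := by
    rw [he, div_lt_one (by positivity)]
    rw [div_lt_iff₀ (by positivity)] at hκ
    linarith
  have heκ : e * κ = ζ⁻¹ / 2 := by
    rw [he]
    field_simp
  have hθ : (4 * κ * ζ - 1) / (2 * κ * ζ) = 2 - e := by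
    rw [he]
    field_simp
    ring
  have hc : maxLaplacianEigenvalue G ^ 2 ≤ ζ⁻¹ := hζ ▸ sq_le_inv_zeta hn0 hσ
  have ha : ∀ i, pr.a i ≤ ζ⁻¹ := fun i => hζ ▸ a_le_inv_zeta hn0 hσ i
  obtain ⟨ε₁, hε₁, hle₁⟩ := exists_le_slack hG hn hΦ he0 heκ ha hc
  obtain ⟨ε₂, hε₂, hle₂⟩ := exists_le_slack_sub_coupling hG hn hΦ he0 he1 heκ ha hc
  have hstep : ∀ k, η k * (1 + 2 * (χ / √n)) ≤ 2 - e := by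
    intro k
    have hpos : 0 < 1 + 2 * ((χ : ℝ) / √n) := by positivity
    have h := hη_upper k
    rw [hθ, mul_div_assoc, one_div, inv_mul_eq_div, lt_div_iff₀ hpos] at h
    exact h.le
  have hconv := ae_tendsto_zero_of_async (B := phiBilin G sMu⁻¹ sZ⁻¹ sG⁻¹)
    (S := pdResidual pr G sMu sZ sG) (ε := min ε₁ ε₂) (x := fun k ω => (w k ω).blocks)
    (x0 := w0.blocks) hn0 hact hτ phiBilin_symm hκ0 ?_ continuous_residual
    (exists_residual_eq_zero hG hsMu.ne' hsZ.ne' hsG hSlater) (lt_min hε₁ hε₂) ?_ ?_ hηmin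
    hη_lower hstep (fun ω => congrArg State.blocks (hw ω).init) (fun k ω => (hw ω).blocks_succ k)
  · filter_upwards [hconv] with ω hω
    obtain ⟨y, hy, hlim⟩ := hω
    obtain ⟨m, hm, hopt⟩ :=
      exists_isPrimalDualOptimal_of_residual_eq_zero hG hsMu.ne' hsZ.ne' hsG hlohi hy
    rw [tendsto_pi_nhds] at hlim
    refine ⟨(toState y).P, m, hopt, fun i => ?_, fun i => ?_⟩
    · exact ((continuous_snd.comp continuous_snd).tendsto (y i)).comp (hlim i)
    · rw [← hm i]
      exact (continuous_fst.tendsto (y i)).comp (hlim i)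
  · intro x
    rw [phiBilin_self]
    exact (mul_le_mul_of_nonneg_left (norm_sq_le_sum x) hκ0.le).trans (hΦ.le_form _ _ _)
  · intro x y hy
    have h1 := (le_phiBilin_residual hsMu.ne' hsZ.ne' hsG hlohi e hy (x := x)).2
    have h2 := fun v => (mul_le_mul (min_le_left ε₁ ε₂)
      (norm_sq_le_sum (pdResidual pr G sMu sZ sG x)) (sq_nonneg _) hε₁.le).trans (hle₁ _ _ _ v)
    rw [phiBilin_self]
    exact le_trans (by gcongr; exact h2 _) h1
  · intro x y hy
    obtain ⟨hv, h1⟩ := le_phiBilin_residual hsMu.ne' hsZ.ne' hsG hlohi e hy (x := x)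
    have h2 := (hle₂ _ _ _ _ hv).trans' (mul_le_mul (min_le_right ε₁ ε₂)
      (norm_sq_le_sum (pdResidual pr G sMu sZ sG x)) (sq_nonneg _) hε₂.le)
    rw [sum_phiBilin_single]
    linarith
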